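/- Let $n\ge 1$ and $r\ge 0$ be integers, $x=(x_1,\dots,x_n)$, $(a)_k=a(a+1)\cdots(a+k-1)$, and $$f_r(x;\gamma)=\sum_{\nu_1+\dots+\nu_n=r}\frac{r!}{\nu_1!\cdots\nu_n!}\,(\gamma)_{\nu_1}\cdots(\gamma)_{\nu_n}\;x_1^{r-\nu_1}\cdots x_n^{r-\nu_n},$$ the sum being over $n$-tuples $\nu$ of nonnegative integers. For a partition $\lambda$ with at most $n$ parts let $P_\lambda^{(\alpha)}(x)$ be the Jack polynomial: the symmetric polynomial of the form $m_\lambda+\sum_{\mu<\lambda}c_\mu m_\mu$ ($m_\mu$ the monomial symmetric polynomials, $<$ the dominance order) that is an eigenfunction of $\frac{\alpha}{2}\sum_i x_i^2\partial_i^2+\sum_{i\ne j}\frac{x_i^2}{x_i-x_j}\partial_i$. For an indeterminate $\gamma$, $P_\lambda^{(1/\gamma)}(x)$ has coefficients in $\mathbb Q(\gamma)$; for a complex number $\gamma$ that is not a pole of these coefficients it is obtained by specialisation. Let $(r^{n-1})=(r,\dots,r,0)$. (1) For $\gamma$ an indeterminate, the Jack polynomial $P_{(r^{n-1})}^{(1/\gamma)}(x)$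 exists and is unique, and $$f_r(x;\gamma)=(\gamma)_r\,P_{(r^{n-1})}^{(1/\gamma)}(x).$$ The coefficients of $P_{(r^{n-1})}^{(1/\gamma)}(x)$ have no pole at any $\gamma\in\mathbb C\setminus\{-1,-2,\dots,-(r-1)\}$, and the identity holds for every complex $\gamma$ that is not a pole. (2) Consequently the Richards–Zheng integral is the case $\lambda=(r^{n-1})$ of Kadell's integral, in the following sense. Write $w(x)=\prod_{i<j}|x_i-x_j|^{2\gamma}\prod_{i}x_i^{\alpha-1}(1-x_i)^{\beta-1}$ with $\alpha,\beta,\gamma\in\mathbb C$. The Richards–Zheng formula states that, for $\Re\alpha>0$, $\Re\beta>0$, $\Re\gamma>-\min\{\frac1n,\frac{\Re(\alpha+r)}{n-1},\frac{\Re\beta}{n-1}\}$, $$\int_{[0,1]^n}f_r(x;\gamma)\,w(x)\,dx=(n\gamma)_r\,\frac{\Gamma(\alpha)\Gamma(\alpha+\beta+(n-1)\gamma+r)}{\Gamma(\alpha+r)\Gamma(\alpha+\beta+(n-1)\gamma)}\prod_{i=1}^n\frac{\Gamma(\alpha+(i-1)\gamma+r)\Gamma(\beta+(i-1)\gamma)\Gamma(i\gamma+1)}{\Gamma(\alpha+\beta+(i+n-2)\gamma+r)\Gamma(\gamma+1)}.$$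 Kadell's formula for $\lambda$ states that, for $\Re\alpha>-\lambda_n$, $\Re\beta>0$, $\Re\gamma>-\min\{\frac1n,\frac{\Re(\alpha+\lambda_i)}{n-i}\ (1\le i<n),\frac{\Re\beta}{n-1}\}$, $$\frac1{n!}\int_{[0,1]^n}P_\lambda^{(1/\gamma)}(x)\,w(x)\,dx=\prod_{1\le i<j\le n}\frac{\Gamma((j-i+1)\gamma+\lambda_i-\lambda_j)}{\Gamma((j-i)\gamma+\lambda_i-\lambda_j)}\prod_{i=1}^n\frac{\Gamma(\alpha+(n-i)\gamma+\lambda_i)\Gamma(\beta+(i-1)\gamma)}{\Gamma(\alpha+\beta+(2n-i-1)\gamma+\lambda_i)}.$$ (Each formula includes the absolute convergence of its integral; entries with denominator $n-1$ are omitted when $n=1$.) For $\lambda=(r^{n-1})$ the two sets of conditions on $(\alpha,\beta,\gamma)$ are equivalent. Under them $P_{(r^{n-1})}^{(1/\gamma)}$ has no pole at $\gamma$, and the first integrand is $(\gamma)_r$ times the integrand $P_{(r^{n-1})}^{(1/\gamma)}(x)w(x)$ of the second. If moreover $\gamma\ne0$, then $(\gamma)_r\neq 0$, the right-hand side of the first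 formula is $n!\,(\gamma)_r$ times that of the second, and hence the two formulas are equivalent. For $\gamma=0$, where the right-hand side of Kadell's formula is not literally defined, the Richards–Zheng formula holds. -/

import Mathlib

noncomputable section

namespace JackSelberg

/-! Symmetric polynomials in `x₁, …, xₙ` are elements of `MvPolynomial (Fin n) K`. The variables are
indexed from `0`, so the index `i : Fin n` stands for the `(i+1)`-st variable. A partition with at
most `n` parts is a weakly decreasing function `Fin n → ℕ`. -/

/-- The Pochhammer symbol `(a)_k = a (a+1) ⋯ (a+k-1)`. -/
def poch {R : Type*} [CommRing R] (a : R) (k : ℕ) : R :=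
  (ascPochhammer R k).eval a

/-- The polynomial `f_r(x;γ) = ∑_{|ν|=r} binom(r,ν) (γ)_{ν₁} ⋯ (γ)_{νₙ} x^{r-ν}`; the sum is over all
`ν : Fin n → ℕ` with `∑ ν_i = r`. -/
def richardsZheng {R : Type*} [CommRing R] (n r : ℕ) (γ : R) : MvPolynomial (Fin n) R :=
  ∑ ν ∈ Finset.piAntidiag (Finset.univ : Finset (Fin n)) r,
    MvPolynomial.C ((Nat.multinomial Finset.univ ν : R) * ∏ i, poch γ (ν i)) *
      ∏ i, MvPolynomial.X i ^ (r - ν i)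

/-- The dominance order `μ ≤ lam` on partitions: equal size, and every partial sum
`μ₁ + ⋯ + μ_k` is at most `lam₁ + ⋯ + lam_k`. -/
def DominatedBy {n : ℕ} (μ lam : Fin n → ℕ) : Prop :=
  ∑ i, μ i = ∑ i, lam i ∧
    ∀ k : Fin n, ∑ i ∈ Finset.Iic k, μ i ≤ ∑ i ∈ Finset.Iic k, lam i

/-- The Laplace–Beltrami (Calogero–Sutherland) operator
`D(α) = (α/2) ∑_i x_i² ∂_i² + ∑_{i ≠ j} x_i² / (x_i - x_j) ∂_i`
applied to a polynomial, with values in the field of rational functions in `x`. -/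
def laplaceBeltrami {K : Type*} [Field K] {n : ℕ} (α : K) (P : MvPolynomial (Fin n) K) :
    FractionRing (MvPolynomial (Fin n) K) :=
  let ι := algebraMap (MvPolynomial (Fin n) K) (FractionRing (MvPolynomial (Fin n) K))
  ι (MvPolynomial.C (α / 2) *
      ∑ i, MvPolynomial.X i ^ 2 * MvPolynomial.pderiv i (MvPolynomial.pderiv i P)) +
    ∑ i, ∑ j ∈ Finset.univ.erase i,
      ι (MvPolynomial.X i) ^ 2 / (ι (MvPolynomial.X i) - ι (MvPolynomial.X j)) *
        ι (MvPolynomial.pderiv i P)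

/-- `P` is a Jack polynomial `P_lam^{(α)}(x₁, …, xₙ)`: it is a symmetric polynomial of the form
`m_lam + ∑_{μ < lam} c_μ m_μ` (`m_μ` the monomial symmetric polynomials, `<` the dominance order)
and an eigenfunction of `D(α)`. As `P` is symmetric, the coefficient of `m_μ` in `P` is the
coefficient of `x^μ`. -/
structure IsJack {K : Type*} [Field K] {n : ℕ} (α : K) (lam : Fin n → ℕ)
    (P : MvPolynomial (Fin n) K) : Prop where
  symmetric : P.IsSymmetric
  coeff_self : P.coeff (Finsupp.equivFunOnFinite.symm lam) = 1
  triangular : ∀ μ : Fin n → ℕ, Antitone μ →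
    P.coeff (Finsupp.equivFunOnFinite.symm μ) ≠ 0 → DominatedBy μ lam
  eigen : ∃ e : K, laplaceBeltrami α P =
    algebraMap (MvPolynomial (Fin n) K) (FractionRing (MvPolynomial (Fin n) K))
      (MvPolynomial.C e * P)

/-- The Jack polynomial `P_lam^{(1/γ)}(x₁, …, xₙ)` for an indeterminate `γ`; its coefficients
are rational functions of `γ`, the variable `RatFunc.X` of `RatFunc ℚ`. -/
def jack {n : ℕ} (lam : Fin n → ℕ) : MvPolynomial (Fin n) (RatFunc ℚ) :=
  Classical.epsilon (IsJack (RatFunc.X : RatFunc ℚ)⁻¹ lam)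

/-- No coefficient of `P_lam^{(1/γ)}(x₁, …, xₙ)` has a pole at the complex number `γ`. -/
def JackRegularAt {n : ℕ} (lam : Fin n → ℕ) (γ : ℂ) : Prop :=
  ∀ m : Fin n →₀ ℕ, ((jack lam).coeff m).denom.eval₂ (algebraMap ℚ ℂ) γ ≠ 0

/-- The Jack polynomial `P_lam^{(1/γ)}(x₁, …, xₙ)` for a complex number `γ` at which it is regular:
the coefficients are evaluated at `γ`. -/
def jackAt {n : ℕ} (lam : Fin n → ℕ) (γ : ℂ) : MvPolynomial (Fin n) ℂ :=
  ∑ m ∈ (jack lam).support,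
    MvPolynomial.monomial m (RatFunc.eval (algebraMap ℚ ℂ) γ ((jack lam).coeff m))

/-- The partition `(r^{n-1}) = (r, …, r, 0)`. -/
def rect (n r : ℕ) : Fin n → ℕ := fun i => if (i : ℕ) + 1 < n then r else 0

/-- The Selberg weight `∏_{i<j} |x_i - x_j|^{2γ} ∏_i x_i^{α-1} (1-x_i)^{β-1}`. -/
def selbergWeight (n : ℕ) (α β γ : ℂ) (x : Fin n → ℝ) : ℂ :=
  (∏ i, ∏ j ∈ Finset.Ioi i, ((|x i - x j| : ℝ) : ℂ) ^ (2 * γ)) *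
    ∏ i, ((x i : ℂ) ^ (α - 1) * ((1 - x i : ℝ) : ℂ) ^ (β - 1))

/-- The value at a real point of a polynomial with complex coefficients. -/
def evalReal {n : ℕ} (P : MvPolynomial (Fin n) ℂ) (x : Fin n → ℝ) : ℂ :=
  MvPolynomial.eval (fun i => (x i : ℂ)) P

/-- The integrand of the Richards–Zheng integral. -/
def rzIntegrand (n r : ℕ) (α β γ : ℂ) (x : Fin n → ℝ) : ℂ :=
  evalReal (richardsZheng n r γ) x * selbergWeight n α β γ x

/-- The value of the Richards–Zheng integral. -/
def rzValue (n r : ℕ) (α β γ : ℂ) : ℂ :=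
  poch (n * γ) r *
    (Complex.Gamma α * Complex.Gamma (α + β + (n - 1) * γ + r) /
      (Complex.Gamma (α + r) * Complex.Gamma (α + β + (n - 1) * γ))) *
    ∏ i : Fin n,
      Complex.Gamma (α + (i : ℕ) * γ + r) * Complex.Gamma (β + (i : ℕ) * γ) *
          Complex.Gamma (((i : ℕ) + 1) * γ + 1) /
        (Complex.Gamma (α + β + ((i : ℕ) + n - 1) * γ + r) * Complex.Gamma (γ + 1))

/-- The condition `Re α > 0`, `Re β > 0`,
`Re γ > - min {1/n, Re(α+r)/(n-1), Re β/(n-1)}`; the last two entries are absent for `n = 1`. -/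
def RZCondition (n r : ℕ) (α β γ : ℂ) : Prop :=
  0 < α.re ∧ 0 < β.re ∧ -(1 / (n : ℝ)) < γ.re ∧
    -(α.re + r) < ((n : ℝ) - 1) * γ.re ∧ -β.re < ((n : ℝ) - 1) * γ.re

/-- The Richards–Zheng integral converges and has the stated value. -/
def RZFormula (n r : ℕ) (α β γ : ℂ) : Prop :=
  MeasureTheory.IntegrableOn (rzIntegrand n r α β γ) (Set.Icc 0 1) ∧
    ∫ x in Set.Icc (0 : Fin n → ℝ) 1, rzIntegrand n r α β γ x = rzValue n r α β γ

/-- The integrand of Kadell's integral. -/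
def kadellIntegrand {n : ℕ} (lam : Fin n → ℕ) (α β γ : ℂ) (x : Fin n → ℝ) : ℂ :=
  evalReal (jackAt lam γ) x * selbergWeight n α β γ x

/-- The value of Kadell's integral. -/
def kadellValue {n : ℕ} (lam : Fin n → ℕ) (α β γ : ℂ) : ℂ :=
  (∏ i : Fin n, ∏ j ∈ Finset.Ioi i,
      Complex.Gamma ((((j : ℕ) : ℂ) - (i : ℕ) + 1) * γ + lam i - lam j) /
        Complex.Gamma ((((j : ℕ) : ℂ) - (i : ℕ)) * γ + lam i - lam j)) *
    ∏ i : Fin n,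
      Complex.Gamma (α + ((n : ℂ) - 1 - (i : ℕ)) * γ + lam i) *
          Complex.Gamma (β + (i : ℕ) * γ) /
        Complex.Gamma (α + β + (2 * (n : ℂ) - 2 - (i : ℕ)) * γ + lam i)

/-- The condition `Re α > -lam_n`, `Re β > 0`,
`Re γ > - min {1/n, Re(α+lam_i)/(n-i), Re β/(n-1)}` with `1 ≤ i ≤ n-1`. In the quantified
clause the last index gives `Re α > -lam_n`. -/
def KadellCondition {n : ℕ} (lam : Fin n → ℕ) (α β γ : ℂ) : Prop :=
  (∀ i : Fin n, -(α.re + lam i) < ((n : ℝ) - 1 - (i : ℕ)) * γ.re) ∧ 0 < β.re ∧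
    -(1 / (n : ℝ)) < γ.re ∧ -β.re < ((n : ℝ) - 1) * γ.re

/-- Kadell's integral converges and has the stated value. -/
def KadellFormula {n : ℕ} (lam : Fin n → ℕ) (α β γ : ℂ) : Prop :=
  MeasureTheory.IntegrableOn (kadellIntegrand lam α β γ) (Set.Icc 0 1) ∧
    (1 / (n.factorial : ℂ)) * ∫ x in Set.Icc (0 : Fin n → ℝ) 1, kadellIntegrand lam α β γ x =
      kadellValue lam α β γ

end JackSelberg

end

noncomputable section

namespace JackSelberg

open MvPolynomial Finset
open scoped MonomialOrder

/-! ### Euler operators on monomials -/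

section Euler

variable {σ R : Type*} [CommRing R]

/-! Pairing the terms `(i, j)` and `(j, i)` turns `D(α)` on symmetric polynomials into a polynomial
operator: its first-order part is half the sum, over ordered pairs, of the divided differences `R_ij
= (x_i² ∂_i P - x_j² ∂_j P) / (x_i - x_j)`. Both uniqueness and existence are read off from this
form.

Uniqueness: if `x^μ` is the lex-leading monomial of a symmetric `P`, then `R_ij` with `i < j` has
coefficient `μ_i` times that of `P` at `x^μ`, so an eigenvalue must be `α/2 ∑ μ_i (μ_i - 1) + ∑ (n -
i) μ_i` with `i` counted from 1. The difference of two Jack polynomials for `lam`, if nonzero, would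
lead with some `μ` dominated by `lam` and having the same eigenvalue. For `α = 1/γ` with `γ` an
indeterminate the two parts of the eigenvalue agree separately; the second part is, up to the size
of `μ`, the total of the partial sums, so dominance forces `μ = lam`, where the coefficients cancel
(`IsJack.unique`).

Existence: write `f_r = ∑ c_ν x^{r-ν}`. Moving a unit of `ν` from `i` to `j`, giving `ν'`, one has
`c_ν ν_i (γ + ν_j) = c_ν' ν'_j (γ + ν'_i)`. Hence `R_ij = ∑ c_ν (r + ν_i ν_j / γ) x^{r-ν}`, and `∑
ν_i = r` makes `D(1/γ)` act on every monomial of `f_r` by the same scalar. The leading coefficient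
of `f_r` is `(γ)_r`. Its factor `γ`, present when `r ≥ 1`, divides every coefficient of `f_r`, so
only the factors `γ + 1, …, γ + r - 1` can give poles.

For the integrals, the double product of Gamma quotients in Kadell's value telescopes for
`(r^{n-1})`, first in `j`, then in `i`. At `γ = 0` the integrand and the value vanish if `r > 0`,
and for `r = 0` the integral is a power of the beta integral. -/

lemma coeff_X_mul_pderiv (i : σ) (P : MvPolynomial σ R) (d : σ →₀ ℕ) :
    (X i * pderiv i P).coeff d = d i * P.coeff d := by
  classical
  induction P using MvPolynomial.induction_on' with
  | monomial m c =>
    rw [X_mul_pderiv_monomial, coeff_smul, coeff_monomial]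
    split_ifs with h
    · subst h; simp
    · simp
  | add p q hp hq => simp [mul_add, hp, hq]

lemma X_sq_mul_pderiv_pderiv (i : σ) (P : MvPolynomial σ R) :
    X i ^ 2 * pderiv i (pderiv i P) =
      X i * pderiv i (X i * pderiv i P) - X i * pderiv i P := by
  simp only [Derivation.leibniz, pderiv_X_self, smul_eq_mul]
  ring

lemma coeff_X_sq_mul_pderiv_pderiv (i : σ) (P : MvPolynomial σ R) (d : σ →₀ ℕ) :
    (X i ^ 2 * pderiv i (pderiv i P)).coeff d = d i * (d i - 1) * P.coeff d := by
  rw [X_sq_mul_pderiv_pderiv, coeff_sub]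
  simp only [coeff_X_mul_pderiv]
  ring

end Euler

/-! ### Eigenvalues of the Laplace–Beltrami operator and uniqueness of Jack polynomials -/

section LaplaceBeltrami

variable {K : Type*} [Field K] {n : ℕ}

lemma algebraMap_X_sub_X_ne_zero {i j : Fin n} (h : i ≠ j) :
    algebraMap (MvPolynomial (Fin n) K) (FractionRing (MvPolynomial (Fin n) K)) (X i) -
      algebraMap (MvPolynomial (Fin n) K) (FractionRing (MvPolynomial (Fin n) K)) (X j) ≠ 0 := by
  rw [sub_ne_zero]
  intro h'
  exact h (X_injective (IsFractionRing.injective (MvPolynomial (Fin n) K) _ h'))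

/-- Pairing the terms `(i, j)` and `(j, i)`, the operator `D(α)` becomes polynomial as soon as the
divided differences of `x_i² ∂_i P` are known. -/
lemma laplaceBeltrami_eq [CharZero K] (α : K) (P : MvPolynomial (Fin n) K)
    (R : Fin n → Fin n → MvPolynomial (Fin n) K)
    (hR : ∀ i j, i ≠ j →
      (X i - X j) * R i j = X i ^ 2 * pderiv i P - X j ^ 2 * pderiv j P) :
    laplaceBeltrami α P = algebraMap _ (FractionRing (MvPolynomial (Fin n) K))
      (C (α / 2) * ∑ i, X i ^ 2 * pderiv i (pderiv i P) +
        C (1 / 2) * ∑ i, ∑ j ∈ univ.erase i, R i j) := by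
  set ι := algebraMap (MvPolynomial (Fin n) K) (FractionRing (MvPolynomial (Fin n) K)) with hι
  have hswap : ∀ F : Fin n → Fin n → FractionRing (MvPolynomial (Fin n) K),
      ∑ i, ∑ j ∈ univ.erase i, F i j = ∑ i, ∑ j ∈ univ.erase i, F j i := by
    intro F
    refine sum_comm' ?_
    intro x y
    simp [eq_comm]
  have key : ∑ i, ∑ j ∈ univ.erase i, ι (R i j) =
      2 * ∑ i, ∑ j ∈ univ.erase i,
        ι (X i) ^ 2 / (ι (X i) - ι (X j)) * ι (pderiv i P) := by
    rw [two_mul]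
    nth_rewrite 2 [hswap]
    rw [← sum_add_distrib]
    refine sum_congr rfl fun i _ => ?_
    rw [← sum_add_distrib]
    refine sum_congr rfl fun j hj => ?_
    have hij : i ≠ j := (ne_of_mem_erase hj).symm
    have h1 := algebraMap_X_sub_X_ne_zero (K := K) hij
    have h2 := algebraMap_X_sub_X_ne_zero (K := K) hij.symm
    rw [← hι] at h1 h2
    have h3 := congrArg ι (hR i j hij)
    simp only [map_mul, map_sub, map_pow] at h3
    rw [← mul_right_inj' h1, h3]
    field_simp
    ring
  have h2 : ι (C (1 / 2)) * 2 = 1 := by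
    have : (C (1 / 2) * 2 : MvPolynomial (Fin n) K) = 1 := by
      rw [← map_ofNat C 2, ← C_mul]; simp
    rw [← map_ofNat ι 2, ← map_mul, this, map_one]
  unfold laplaceBeltrami
  simp only [← hι]
  rw [map_add, map_mul ι (C (1 / 2)), map_sum ι (fun i => ∑ j ∈ univ.erase i, R i j)]
  simp only [map_sum ι (fun j => R _ j)]
  rw [key, ← mul_assoc, h2, one_mul]

/-- Modulo `X i - X j` the swap fixes every variable, hence every polynomial. -/
lemma X_sub_X_dvd_sub_rename_swap (i j : Fin n) (P : MvPolynomial (Fin n) K) :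
    (X i - X j : MvPolynomial (Fin n) K) ∣ P - rename (Equiv.swap i j) P := by
  rw [← Ideal.mem_span_singleton, ← Ideal.Quotient.eq]
  set I := Ideal.span {(X i - X j : MvPolynomial (Fin n) K)}
  have hij : Ideal.Quotient.mk I (X i) = Ideal.Quotient.mk I (X j) :=
    Ideal.Quotient.eq.2 (Ideal.mem_span_singleton_self _)
  have h : (Ideal.Quotient.mkₐ K I) = (Ideal.Quotient.mkₐ K I).comp (rename (Equiv.swap i j)) := by
    apply MvPolynomial.algHom_ext
    intro k
    simp only [AlgHom.comp_apply, rename_X, Ideal.Quotient.mkₐ_eq_mk]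
    rcases eq_or_ne k i with rfl | hi
    · simpa using hij
    rcases eq_or_ne k j with rfl | hj
    · simpa using hij.symm
    · rw [Equiv.swap_apply_of_ne_of_ne hi hj]
  exact DFunLike.congr_fun h P

/-- The numerator `N` changes sign under the swap, so `N` minus its image is `2 N`, which is
divisible by `X i - X j`; then halve. -/
lemma exists_dividedDifference [CharZero K] {P : MvPolynomial (Fin n) K} (hP : P.IsSymmetric)
    (i j : Fin n) :
    ∃ R, (X i - X j) * R = X i ^ 2 * pderiv i P - X j ^ 2 * pderiv j P := by
  set N := X i ^ 2 * pderiv i P - X j ^ 2 * pderiv j P with hN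
  have h1 : rename (Equiv.swap i j) (pderiv i P) = pderiv j P := by
    have := pderiv_rename (Equiv.swap i j).injective i P
    rw [hP, Equiv.swap_apply_left] at this
    exact this.symm
  have h2 : rename (Equiv.swap i j) (pderiv j P) = pderiv i P := by
    have := pderiv_rename (Equiv.swap i j).injective j P
    rw [hP, Equiv.swap_apply_right] at this
    exact this.symm
  have hs : rename (Equiv.swap i j) N = -N := by
    simp [hN, h1, h2]
  obtain ⟨R, hR⟩ := X_sub_X_dvd_sub_rename_swap i j N
  rw [hs, sub_neg_eq_add, ← two_mul] at hR
  refine ⟨C (1 / 2) * R, ?_⟩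
  have : (C (1 / 2) * 2 : MvPolynomial (Fin n) K) = 1 := by
    rw [← map_ofNat C 2, ← C_mul]; simp
  linear_combination (-C (1 / 2)) * hR + N * this

/-- The eigenvalue of `D(α)` on a symmetric polynomial with leading monomial `x^μ`. -/
def jackEigenvalue (α : K) (μ : Fin n → ℕ) : K :=
  α / 2 * ∑ i, (μ i : K) * (μ i - 1) + ∑ i, ∑ _j ∈ Ioi i, (μ i : K)

lemma lex_single_lt {i j : Fin n} (hij : i < j) :
    Finsupp.single j 1 ≺[(MonomialOrder.lex : MonomialOrder (Fin n))] Finsupp.single i 1 := by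
  rw [MonomialOrder.lex_lt_iff]
  refine ⟨i, fun k hk => ?_, ?_⟩
  · simp [hk.ne', (hk.trans hij).ne']
  · simp [hij.ne]

lemma degree_X_mul_pderiv_le (m : MonomialOrder (Fin n)) (i : Fin n)
    (P : MvPolynomial (Fin n) K) : m.degree (X i * pderiv i P) ≼[m] m.degree P := by
  rw [m.degree_le_iff]
  intro d hd
  rw [mem_support_iff, coeff_X_mul_pderiv] at hd
  exact m.le_degree (mem_support_iff.2 (right_ne_zero_of_mul hd))

/-- For `i < j` the leading term of `X i - X j` is `X i`, so the coefficient of `R` at `μ` is that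
of the numerator at `e_i + μ`. The term in `∂_j` has degree at most `e_j + μ`, which is smaller, and
contributes nothing. -/
lemma coeff_dividedDifference {P R : MvPolynomial (Fin n) K} {i j : Fin n} (hij : i < j)
    (hR : (X i - X j) * R = X i ^ 2 * pderiv i P - X j ^ 2 * pderiv j P) :
    R.coeff (MonomialOrder.lex.degree P) =
      MonomialOrder.lex.degree P i * P.coeff (MonomialOrder.lex.degree P) := by
  set m : MonomialOrder (Fin n) := MonomialOrder.lex
  set μ := m.degree P with hμ
  have hX : ∀ k, m.degree (X k : MvPolynomial (Fin n) K) = Finsupp.single k 1 := fun k =>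
    m.degree_X
  have hlt : m.degree (X j : MvPolynomial (Fin n) K) ≺[m] m.degree (X i : MvPolynomial (Fin n) K) := by
    rw [hX, hX]; exact lex_single_lt hij
  have hdeg : m.degree (X i - X j : MvPolynomial (Fin n) K) = Finsupp.single i 1 := by
    rw [sub_eq_add_neg, m.degree_add_of_lt (by rwa [m.degree_neg]), hX]
  have hne : (X i - X j : MvPolynomial (Fin n) K) ≠ 0 :=
    sub_ne_zero.2 fun h => hij.ne (X_injective h)
  have hterm : ∀ k, m.degree (X k ^ 2 * pderiv k P) ≼[m] Finsupp.single k 1 + μ := by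
    intro k
    rw [pow_two, mul_assoc]
    refine m.degree_mul_le.trans ?_
    rw [map_add, map_add, hX]
    exact add_le_add_right (degree_X_mul_pderiv_le m k P) _
  have hji : Finsupp.single j 1 + μ ≺[m] Finsupp.single i 1 + μ := by
    rw [map_add, map_add]
    exact add_lt_add_left (lex_single_lt hij) _
  have hN : m.degree ((X i - X j) * R) ≼[m] Finsupp.single i 1 + μ := by
    rw [hR]
    refine m.degree_sub_le.trans (sup_le (hterm i) ((hterm j).trans hji.le))
  have hRle : m.degree R ≼[m] μ := by
    by_cases hR0 : R = 0
    · rw [hR0, m.degree_zero, map_zero]; exact m.zero_le _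
    · rw [m.degree_mul hne hR0, hdeg, map_add, map_add] at hN
      exact le_of_add_le_add_left hN
  have h1 := m.coeff_mul_of_add_of_degree_le (f := X i - X j) (g := R) (a := Finsupp.single i 1)
    (b := μ) (by rw [hdeg]) hRle
  have hc : (X i - X j : MvPolynomial (Fin n) K).coeff (Finsupp.single i 1) = 1 := by
    simp [coeff_X, Finsupp.single_left_inj, hij.ne']
  rw [hc, one_mul, hR, coeff_sub, m.coeff_eq_zero_of_lt ((hterm j).trans_lt hji), sub_zero,
    pow_two, mul_assoc, coeff_X_mul, coeff_X_mul_pderiv] at h1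
  exact h1.symm

/-- Compare coefficients at the lex-leading monomial, using `R i j = R j i` to reduce to `i < j`. -/
lemma eigenvalue_eq_of_eigen [CharZero K] {α e : K} {P : MvPolynomial (Fin n) K}
    (hP : P.IsSymmetric) (h0 : P ≠ 0)
    (he : laplaceBeltrami α P = algebraMap _ (FractionRing (MvPolynomial (Fin n) K)) (C e * P)) :
    e = jackEigenvalue α (MonomialOrder.lex.degree P) := by
  choose R hR using exists_dividedDifference hP
  have hsymm : ∀ i j, i ≠ j → R i j = R j i := by
    intro i j hij
    have hne : (X i - X j : MvPolynomial (Fin n) K) ≠ 0 :=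
      sub_ne_zero.2 fun h => hij (X_injective h)
    rw [← mul_right_inj' hne]
    linear_combination hR i j + hR j i
  rw [laplaceBeltrami_eq α P R fun i j _ => hR i j] at he
  have he' := IsFractionRing.injective (MvPolynomial (Fin n) K) _ he
  set μ := MonomialOrder.lex.degree P with hμ
  have hc : P.coeff μ ≠ 0 := MonomialOrder.lex.coeff_degree_ne_zero_iff.2 h0
  have h2 : ∑ i, ∑ j ∈ univ.erase i, (R i j).coeff μ =
      2 * ∑ i, ∑ j ∈ Ioi i, (R i j).coeff μ := by
    have hsplit : ∀ i : Fin n, univ.erase i = Iio i ∪ Ioi i := by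
      intro i; ext j; simp [lt_or_lt_iff_ne]
    have hdisj : ∀ i : Fin n, Disjoint (Iio i) (Ioi i) := fun i =>
      disjoint_left.2 fun j h h' => lt_asymm (mem_Iio.1 h) (mem_Ioi.1 h')
    simp only [hsplit, sum_union (hdisj _)]
    rw [sum_add_distrib, two_mul]
    congr 1
    rw [sum_comm' (t' := univ) (s' := fun j => Ioi j) (by simp)]
    refine sum_congr rfl fun i _ => sum_congr rfl fun j hj => ?_
    rw [hsymm j i (mem_Ioi.1 hj).ne']
  have hcoef := congrArg (coeff μ) he'
  rw [coeff_add, coeff_C_mul, coeff_C_mul, coeff_C_mul, coeff_sum, coeff_sum] at hcoef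
  simp only [coeff_sum] at hcoef
  rw [h2] at hcoef
  simp only [coeff_X_sq_mul_pderiv_pderiv] at hcoef
  have h3 : ∑ i, ∑ j ∈ Ioi i, (R i j).coeff μ =
      (∑ i, ∑ _j ∈ Ioi i, (μ i : K)) * P.coeff μ := by
    simp only [sum_mul]
    exact sum_congr rfl fun i _ => sum_congr rfl fun j hj =>
      coeff_dividedDifference (mem_Ioi.1 hj) (hR i j)
  rw [h3, ← sum_mul] at hcoef
  apply mul_right_cancel₀ hc
  rw [← hcoef, jackEigenvalue]
  ring

/-- Swapping an increasing pair of exponents would give a lex-larger monomial with the same nonzero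
coefficient. -/
lemma antitone_degree_of_isSymmetric {P : MvPolynomial (Fin n) K} (hP : P.IsSymmetric)
    (h0 : P ≠ 0) : Antitone (MonomialOrder.lex.degree P : Fin n → ℕ) := by
  set μ := MonomialOrder.lex.degree P with hμ
  intro i j hij
  by_contra! hlt
  have hij' : i < j := lt_of_le_of_ne hij fun h => by simp [h] at hlt
  have hcoef : P.coeff (μ.mapDomain (Equiv.swap i j)) = P.coeff μ := by
    conv_lhs => rw [← hP (Equiv.swap i j)]
    exact coeff_rename_mapDomain _ (Equiv.swap i j).injective _ _
  have hc : P.coeff μ ≠ 0 := MonomialOrder.lex.coeff_degree_ne_zero_iff.2 h0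
  have hle := MonomialOrder.lex.le_degree (mem_support_iff.2 (hcoef.trans_ne hc))
  refine hle.not_gt ?_
  rw [← hμ, MonomialOrder.lex_lt_iff]
  have hval : ∀ k, μ.mapDomain (Equiv.swap i j) k = μ (Equiv.swap i j k) := by
    intro k
    conv_lhs => rw [← Equiv.swap_apply_self i j k]
    exact Finsupp.mapDomain_apply (Equiv.swap i j).injective _ _
  refine ⟨i, fun k hk => ?_, ?_⟩
  · simp only [ofLex_toLex]
    change μ k = μ.mapDomain (Equiv.swap i j) k
    rw [hval, Equiv.swap_apply_of_ne_of_ne hk.ne (hk.trans hij').ne]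
  · change μ i < μ.mapDomain (Equiv.swap i j) i
    rw [hval, Equiv.swap_apply_left]
    exact hlt

lemma sum_Iic_eq (μ : Fin n → ℕ) (k : Fin n) :
    ∑ i ∈ Iic k, μ i = μ k + ∑ i ∈ Iio k, μ i := by
  rw [← Iio_insert, sum_insert (by simp)]

lemma DominatedBy.eq_of_sum_eq {μ lam : Fin n → ℕ} (h : DominatedBy μ lam)
    (hs : ∑ k : Fin n, ∑ i ∈ Iic k, μ i = ∑ k : Fin n, ∑ i ∈ Iic k, lam i) : μ = lam := by
  have hk := (sum_eq_sum_iff_of_le fun k _ => h.2 k).1 hs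
  funext i
  induction i using WellFoundedLT.induction with
  | ind i ih =>
    have := hk i (mem_univ i)
    have hlt : ∑ k ∈ Iio i, μ k = ∑ k ∈ Iio i, lam k :=
      sum_congr rfl fun k hk => ih k (mem_Iio.1 hk)
    rw [sum_Iic_eq, sum_Iic_eq] at this
    omega

/-- Links dominance with the eigenvalue: `μ i` enters the partial sum at `i` itself and at each
later index. -/
lemma sum_Iic_eq_sum_Ioi (μ : Fin n → ℕ) :
    ∑ k : Fin n, ∑ i ∈ Iic k, μ i = ∑ i, μ i + ∑ i : Fin n, ∑ _j ∈ Ioi i, μ i := by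
  simp only [sum_Iic_eq, sum_add_distrib]
  rw [sum_comm' (t' := univ) (s' := fun j => Ioi j) (by simp)]

lemma DominatedBy.toLex_le {μ lam : Fin n →₀ ℕ} (h : DominatedBy (μ : Fin n → ℕ) lam) :
    toLex μ ≤ toLex lam := by
  by_contra! hlt
  obtain ⟨k, hk, hlt⟩ := hlt
  have hk' : ∀ i < k, lam i = μ i := hk
  have hlt' : lam k < μ k := hlt
  have := h.2 k
  have hsum : ∑ i ∈ Iio k, lam i = ∑ i ∈ Iio k, μ i :=
    sum_congr rfl fun i hi => hk' i (mem_Iio.1 hi)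
  rw [sum_Iic_eq, sum_Iic_eq] at this
  omega

/-- Triangularity constrains only weakly decreasing exponents; the leading one is such, and
dominance implies the lex order. -/
lemma IsJack.degree_eq {α : K} {lam : Fin n → ℕ} {P : MvPolynomial (Fin n) K}
    (h : IsJack α lam P) :
    MonomialOrder.lex.degree P = Finsupp.equivFunOnFinite.symm lam := by
  have h0 : P ≠ 0 := by
    rintro rfl
    simpa using h.coeff_self
  refine MonomialOrder.lex.toSyn.injective (le_antisymm ?_ ?_)
  · refine DominatedBy.toLex_le ?_
    refine h.triangular _ (antitone_degree_of_isSymmetric h.symmetric h0) ?_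
    simpa using h0
  · exact MonomialOrder.lex.le_degree (mem_support_iff.2 (by simp [h.coeff_self]))

/-- Jack polynomials are unique when `1` is not a rational multiple of `α`, so that the eigenvalues
of `D(α)` separate the partitions comparable with `lam` in the dominance order. -/
theorem IsJack.unique [CharZero K] {α : K}
    (hα : ∀ a b : ℤ, α / 2 * a + b = 0 → b = 0) {lam : Fin n → ℕ}
    {P Q : MvPolynomial (Fin n) K} (hP : IsJack α lam P) (hQ : IsJack α lam Q) : P = Q := by
  by_contra hne
  have h0 : P - Q ≠ 0 := sub_ne_zero.2 hne
  have hsymm : (P - Q).IsSymmetric := hP.symmetric.sub hQ.symmetric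
  have hP0 : P ≠ 0 := by
    rintro rfl
    simpa using hP.coeff_self
  have hQ0 : Q ≠ 0 := by
    rintro rfl
    simpa using hQ.coeff_self
  obtain ⟨e, he⟩ := hP.eigen
  obtain ⟨e', he'⟩ := hQ.eigen
  have h1 := eigenvalue_eq_of_eigen hP.symmetric hP0 he
  have h2 := eigenvalue_eq_of_eigen hQ.symmetric hQ0 he'
  rw [hP.degree_eq] at h1
  rw [hQ.degree_eq, ← h1] at h2
  have hsub : laplaceBeltrami α (P - Q) = laplaceBeltrami α P - laplaceBeltrami α Q := by
    simp only [laplaceBeltrami, map_sub, mul_sub, sum_sub_distrib]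
    ring
  rw [he, he', h2, ← map_sub, ← mul_sub] at hsub
  have h3 := eigenvalue_eq_of_eigen hsymm h0 hsub
  set μ := MonomialOrder.lex.degree (P - Q) with hμ
  have hc : (P - Q).coeff μ ≠ 0 := MonomialOrder.lex.coeff_degree_ne_zero_iff.2 h0
  have hdom : DominatedBy (μ : Fin n → ℕ) lam := by
    have hanti := antitone_degree_of_isSymmetric hsymm h0
    by_cases hPμ : P.coeff μ = 0
    · refine hQ.triangular _ hanti fun hQμ => hc ?_
      rw [coeff_sub, hPμ, zero_sub, neg_eq_zero]
      simpa using hQμ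
    · exact hP.triangular _ hanti (by simpa using hPμ)
  have hμlam : (μ : Fin n → ℕ) = lam := by
    refine hdom.eq_of_sum_eq ?_
    rw [sum_Iic_eq_sum_Ioi, sum_Iic_eq_sum_Ioi, hdom.1]
    -- The difference of the two eigenvalues, split into its `α/2` part and its integer part.
    have := hα (∑ i, (μ i : ℤ) * (μ i - 1) - ∑ i, (lam i : ℤ) * (lam i - 1))
      (∑ i, ∑ _j ∈ Ioi i, (μ i : ℤ) - ∑ i, ∑ _j ∈ Ioi i, (lam i : ℤ)) (by
        rw [h1] at h3
        simp only [jackEigenvalue, Finsupp.equivFunOnFinite_symm_apply_apply] at h3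
        push_cast
        linear_combination -h3)
    rw [sub_eq_zero] at this
    congr 1
    exact_mod_cast this
  apply hc
  have : μ = Finsupp.equivFunOnFinite.symm lam := by
    ext i; simp [← hμlam]
  rw [this, coeff_sub, hP.coeff_self, hQ.coeff_self, sub_self]

end LaplaceBeltrami

lemma ratFunc_inv_X_linear (a b : ℤ) (h : (RatFunc.X : RatFunc ℚ)⁻¹ / 2 * a + b = 0) : b = 0 := by
  have hX : (RatFunc.X : RatFunc ℚ) ≠ 0 := RatFunc.X_ne_zero
  field_simp at h
  have h' : algebraMap (Polynomial ℚ) (RatFunc ℚ)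
      (Polynomial.C (a : ℚ) + Polynomial.X * Polynomial.C 2 * Polynomial.C (b : ℚ)) = 0 := by
    simp only [map_add, map_mul, RatFunc.algebraMap_X, map_intCast, map_ofNat]
    linear_combination h
  have h2 := (map_eq_zero_iff _ (RatFunc.algebraMap_injective ℚ)).1 h'
  have h3 := congrArg (fun p => Polynomial.coeff p 1) h2
  simp only [Polynomial.coeff_add, mul_assoc, Polynomial.coeff_X_mul, ← Polynomial.C_mul,
    Polynomial.coeff_C] at h3
  simpa using h3

/-! ### Coefficients of `f_r` and the exchange relation between them -/

section RichardsZheng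

variable {R : Type*} [CommRing R] {n : ℕ}

lemma poch_zero (a : R) : poch a 0 = 1 := by simp [poch]

lemma poch_succ (a : R) (k : ℕ) : poch a (k + 1) = poch a k * (a + k) := by
  simp [poch, ascPochhammer_succ_eval]

/-- The coefficient `binom(r, ν) (γ)_{ν₁} ⋯ (γ)_{νₙ}` of `f_r(x;γ)`. -/
def rzCoeff (γ : R) (ν : Fin n → ℕ) : R :=
  (Nat.multinomial univ ν : R) * ∏ i, poch γ (ν i)

/-- The exponent `r - ν`. -/
def rzExponent (r : ℕ) (ν : Fin n → ℕ) : Fin n →₀ ℕ :=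
  Finsupp.equivFunOnFinite.symm fun i => r - ν i

lemma rzExponent_apply (r : ℕ) (ν : Fin n → ℕ) (i : Fin n) : rzExponent r ν i = r - ν i := rfl

/-- Guarantees that the natural subtraction `r - ν i` never truncates. -/
lemma le_of_mem_piAntidiag {r : ℕ} {ν : Fin n → ℕ} (hν : ν ∈ piAntidiag univ r) (i : Fin n) :
    ν i ≤ r := by
  rw [mem_piAntidiag] at hν
  rw [← hν.1]
  exact single_le_sum (fun _ _ => Nat.zero_le _) (mem_univ i)

lemma richardsZheng_eq_sum (r : ℕ) (γ : R) :
    richardsZheng n r γ =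
      ∑ ν ∈ piAntidiag (univ : Finset (Fin n)) r, monomial (rzExponent r ν) (rzCoeff γ ν) := by
  refine sum_congr rfl fun ν _ => ?_
  rw [monomial_eq, Finsupp.prod_fintype _ _ (by simp)]
  rfl

lemma rzExponent_injOn (r : ℕ) :
    Set.InjOn (rzExponent r) (piAntidiag (univ : Finset (Fin n)) r : Set (Fin n → ℕ)) := by
  intro ν hν ν' hν' h
  funext i
  have := DFunLike.congr_fun h i
  rw [rzExponent_apply, rzExponent_apply] at this
  have h1 := le_of_mem_piAntidiag (mem_coe.1 hν) i
  have h2 := le_of_mem_piAntidiag (mem_coe.1 hν') i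
  omega

lemma coeff_richardsZheng {r : ℕ} (γ : R) {ν : Fin n → ℕ} (hν : ν ∈ piAntidiag univ r) :
    (richardsZheng n r γ).coeff (rzExponent r ν) = rzCoeff γ ν := by
  rw [richardsZheng_eq_sum, coeff_sum, sum_eq_single ν]
  · simp
  · intro ν' hν' hne
    rw [coeff_monomial, if_neg]
    exact fun h => hne (rzExponent_injOn r (mem_coe.2 hν') (mem_coe.2 hν) h)
  · exact fun h => absurd hν h

lemma exists_of_coeff_richardsZheng_ne_zero {r : ℕ} {γ : R} {m : Fin n →₀ ℕ}
    (h : (richardsZheng n r γ).coeff m ≠ 0) :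
    ∃ ν ∈ piAntidiag (univ : Finset (Fin n)) r, rzExponent r ν = m := by
  rw [richardsZheng_eq_sum, coeff_sum] at h
  obtain ⟨ν, hν, h⟩ := exists_ne_zero_of_sum_ne_zero h
  refine ⟨ν, hν, ?_⟩
  by_contra hne
  rw [coeff_monomial, if_neg hne] at h
  exact h rfl

lemma poch_map {S : Type*} [CommRing S] (φ : R →+* S) (a : R) (k : ℕ) :
    φ (poch a k) = poch (φ a) k := by
  rw [poch, poch, ← ascPochhammer_map φ k, Polynomial.eval_map, Polynomial.eval₂_hom]

/-- Transports `f_r` from `ℚ[X]` both to `ℚ(X)` and, by evaluation, to `ℂ`. -/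
lemma map_richardsZheng {S : Type*} [CommRing S] (φ : R →+* S) (r : ℕ) (γ : R) :
    MvPolynomial.map φ (richardsZheng n r γ) = richardsZheng n r (φ γ) := by
  simp [richardsZheng, poch_map]

lemma richardsZheng_isSymmetric (r : ℕ) (γ : R) : (richardsZheng n r γ).IsSymmetric := by
  intro σ
  rw [richardsZheng_eq_sum, map_sum]
  refine sum_nbij' (fun ν => ν ∘ σ.symm) (fun ν => ν ∘ σ) ?_ ?_ ?_ ?_ ?_
  · intro ν hν
    rw [mem_piAntidiag] at hν ⊢
    exact ⟨(Equiv.sum_comp σ.symm ν).trans hν.1, by simp⟩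
  · intro ν hν
    rw [mem_piAntidiag] at hν ⊢
    exact ⟨(Equiv.sum_comp σ ν).trans hν.1, by simp⟩
  · intro ν _; funext i; simp
  · intro ν _; funext i; simp
  · intro ν _
    rw [rename_monomial]
    have h1 : Finsupp.mapDomain σ (rzExponent r ν) = rzExponent r (ν ∘ σ.symm) := by
      ext i
      conv_lhs => rw [← σ.apply_symm_apply i]
      rw [Finsupp.mapDomain_apply σ.injective]
      rfl
    have h2 : rzCoeff γ ν = rzCoeff γ (ν ∘ σ.symm) := by
      have h3 : (∏ i, poch γ ((ν ∘ σ.symm) i)) = ∏ i, poch γ (ν i) :=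
        Equiv.prod_comp σ.symm fun i => poch γ (ν i)
      have h4 : Nat.multinomial univ (ν ∘ σ.symm) = Nat.multinomial univ ν := by
        unfold Nat.multinomial
        congr 1
        · exact congrArg _ (Equiv.sum_comp σ.symm ν)
        · exact Equiv.prod_comp σ.symm fun i => (ν i).factorial
      rw [rzCoeff, rzCoeff, h3, h4]
    rw [h1, h2]

lemma prod_eq_mul_mul_prod_erase {M : Type*} [CommMonoid M] {i j : Fin n} (hij : i ≠ j)
    (g : Fin n → M) : ∏ k, g k = g i * (g j * ∏ k ∈ (univ.erase i).erase j, g k) := by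
  rw [mul_prod_erase _ _ (mem_erase.2 ⟨hij.symm, mem_univ j⟩), mul_prod_erase _ _ (mem_univ i)]

/-- Moving a unit of `ν` from the index `i` to the index `j`. -/
def shift (i j : Fin n) (ν : Fin n → ℕ) : Fin n → ℕ :=
  fun k => if k = i then ν i - 1 else if k = j then ν j + 1 else ν k

lemma shift_left (i j : Fin n) (ν : Fin n → ℕ) : shift i j ν i = ν i - 1 := by simp [shift]

lemma shift_right {i j : Fin n} (hij : i ≠ j) (ν : Fin n → ℕ) : shift i j ν j = ν j + 1 := by
  simp [shift, hij.symm]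

lemma shift_of_ne {i j k : Fin n} (hi : k ≠ i) (hj : k ≠ j) (ν : Fin n → ℕ) :
    shift i j ν k = ν k := by
  simp [shift, hi, hj]

lemma shift_shift {i j : Fin n} (hij : i ≠ j) {ν : Fin n → ℕ} (hi : ν i ≠ 0) :
    shift j i (shift i j ν) = ν := by
  funext k
  rcases eq_or_ne k j with rfl | hkj
  · rw [shift_left, shift_right hij, Nat.add_sub_cancel]
  rcases eq_or_ne k i with rfl | hki
  · rw [shift_right hij.symm, shift_left]; omega
  · rw [shift_of_ne hkj hki, shift_of_ne hki hkj]

lemma sum_shift {i j : Fin n} (hij : i ≠ j) {ν : Fin n → ℕ} (hi : ν i ≠ 0) :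
    ∑ k, shift i j ν k = ∑ k, ν k := by
  have h : ∀ g : Fin n → ℕ, ∑ k, g k = g i + (g j + ∑ k ∈ (univ.erase i).erase j, g k) := by
    intro g
    rw [add_sum_erase _ _ (mem_erase.2 ⟨hij.symm, mem_univ j⟩), add_sum_erase _ _ (mem_univ i)]
  have hrest : ∑ k ∈ (univ.erase i).erase j, shift i j ν k = ∑ k ∈ (univ.erase i).erase j, ν k :=
    sum_congr rfl fun k hk => shift_of_ne
      (ne_of_mem_erase (mem_of_mem_erase hk)) (ne_of_mem_erase hk) ν
  rw [h, h ν, shift_left, shift_right hij, hrest]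
  omega

lemma multinomial_mul_shift {i j : Fin n} (hij : i ≠ j) {ν : Fin n → ℕ} (hi : ν i ≠ 0) :
    Nat.multinomial univ ν * ν i = Nat.multinomial univ (shift i j ν) * (ν j + 1) := by
  have h1 := Nat.multinomial_spec univ ν
  have h2 := Nat.multinomial_spec univ (shift i j ν)
  rw [sum_shift hij hi, ← h1, prod_eq_mul_mul_prod_erase hij, prod_eq_mul_mul_prod_erase hij,
    shift_left, shift_right hij, prod_congr rfl fun k hk => congrArg Nat.factorial (shift_of_ne
    (ne_of_mem_erase (mem_of_mem_erase hk)) (ne_of_mem_erase hk) ν), Nat.factorial_succ,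
    ← Nat.mul_factorial_pred hi] at h2
  set A := ∏ k ∈ (univ.erase i).erase j, (ν k).factorial
  have hA : 0 < (ν i - 1).factorial * ((ν j).factorial * A) :=
    Nat.mul_pos (Nat.factorial_pos _) (Nat.mul_pos (Nat.factorial_pos _)
      (prod_pos fun k _ => Nat.factorial_pos _))
  refine Nat.eq_of_mul_eq_mul_left hA ?_
  linear_combination -h2

/-- The exchange relation: the multinomials trade `ν i` for `ν j + 1`, while `(γ)_{k+1} = (γ)_k (γ +
k)` trades `γ + ν j` for `γ + ν i - 1`. -/
lemma rzCoeff_shift (γ : R) {i j : Fin n} (hij : i ≠ j) {ν : Fin n → ℕ} (hi : ν i ≠ 0) :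
    rzCoeff γ ν * ν i * (ν j + γ) =
      rzCoeff γ (shift i j ν) * shift i j ν j * (shift i j ν i + γ) := by
  have h := congrArg (Nat.cast : ℕ → R) (multinomial_mul_shift hij hi)
  push_cast at h
  obtain ⟨k, hk⟩ := Nat.exists_eq_succ_of_ne_zero hi
  rw [rzCoeff, rzCoeff, prod_eq_mul_mul_prod_erase hij (fun k => poch γ (ν k)),
    prod_eq_mul_mul_prod_erase hij (fun k => poch γ (shift i j ν k)), shift_left, shift_right hij,
    prod_congr rfl fun k hk => congrArg (poch γ) (shift_of_ne
    (ne_of_mem_erase (mem_of_mem_erase hk)) (ne_of_mem_erase hk) ν), hk, Nat.succ_sub_one,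
    Nat.succ_eq_add_one, poch_succ, poch_succ]
  rw [hk] at h
  push_cast at h ⊢
  linear_combination (poch γ k * (γ + k) * poch γ (ν j) *
    (∏ k ∈ (univ.erase i).erase j, poch γ (ν k)) * (ν j + γ)) * h

lemma single_add_rzExponent_shift {r : ℕ} {i j : Fin n} (hij : i ≠ j) {ν : Fin n → ℕ}
    (hν : ν ∈ piAntidiag univ r) (hi : ν i ≠ 0) :
    Finsupp.single i 1 + rzExponent r ν = Finsupp.single j 1 + rzExponent r (shift i j ν) := by
  have hle := le_of_mem_piAntidiag hν
  have hle' : shift i j ν j ≤ r := by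
    rw [mem_piAntidiag] at hν
    rw [← hν.1, ← sum_shift hij hi]
    exact single_le_sum (f := shift i j ν) (fun _ _ => Nat.zero_le _) (mem_univ j)
  rw [shift_right hij] at hle'
  ext k
  simp only [Finsupp.add_apply, rzExponent_apply]
  rcases eq_or_ne k i with rfl | hki
  · have := hle k
    rw [shift_left, Finsupp.single_eq_same, Finsupp.single_eq_of_ne hij]
    omega
  rcases eq_or_ne k j with rfl | hkj
  · rw [shift_right hij, Finsupp.single_eq_same, Finsupp.single_eq_of_ne hij.symm]
    omega
  · rw [shift_of_ne hki hkj, Finsupp.single_eq_of_ne hki, Finsupp.single_eq_of_ne hkj]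

lemma shift_mem_piAntidiag {r : ℕ} {i j : Fin n} (hij : i ≠ j) {ν : Fin n → ℕ}
    (hν : ν ∈ piAntidiag univ r) (hi : ν i ≠ 0) : shift i j ν ∈ piAntidiag univ r := by
  rw [mem_piAntidiag] at hν ⊢
  exact ⟨(sum_shift hij hi).trans hν.1, by simp⟩

/-- Terms with `ν i = 0` on the left and `ν j = 0` on the right vanish, and `shift` is a bijection
between the remaining index sets. -/
lemma sum_monomial_shift (r : ℕ) (γ : R) {i j : Fin n} (hij : i ≠ j) :
    ∑ ν ∈ piAntidiag (univ : Finset (Fin n)) r,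
      monomial (Finsupp.single i 1 + rzExponent r ν) (rzCoeff γ ν * ν i * (ν j + γ)) =
    ∑ ν ∈ piAntidiag (univ : Finset (Fin n)) r,
      monomial (Finsupp.single j 1 + rzExponent r ν) (rzCoeff γ ν * ν j * (ν i + γ)) := by
  have hfilter : ∀ i j : Fin n, ∑ ν ∈ piAntidiag (univ : Finset (Fin n)) r,
      monomial (Finsupp.single i 1 + rzExponent r ν) (rzCoeff γ ν * ν i * (ν j + γ)) =
      ∑ ν ∈ piAntidiag (univ : Finset (Fin n)) r with ν i ≠ 0,
      monomial (Finsupp.single i 1 + rzExponent r ν) (rzCoeff γ ν * ν i * (ν j + γ)) := by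
    intro i j
    refine (sum_filter_of_ne (p := fun ν : Fin n → ℕ => ν i ≠ 0) fun ν _ h h0 => h ?_).symm
    simp [h0]
  rw [hfilter i j, hfilter j i]
  refine sum_nbij' (shift i j) (shift j i) ?_ ?_ ?_ ?_ ?_
  · intro ν hν
    rw [mem_filter] at hν ⊢
    exact ⟨shift_mem_piAntidiag hij hν.1 hν.2, by rw [shift_right hij]; omega⟩
  · intro ν hν
    rw [mem_filter] at hν ⊢
    exact ⟨shift_mem_piAntidiag hij.symm hν.1 hν.2, by rw [shift_right hij.symm]; omega⟩
  · intro ν hν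
    exact shift_shift hij (mem_filter.1 hν).2
  · intro ν hν
    exact shift_shift hij.symm (mem_filter.1 hν).2
  · intro ν hν
    rw [mem_filter] at hν
    rw [single_add_rzExponent_shift hij hν.1 hν.2, rzCoeff_shift γ hij hν.2]

end RichardsZheng

/-! ### `f_r` as an eigenfunction -/

section Eigenfunction

variable {K : Type*} [Field K] {n : ℕ}

lemma X_mul_pderiv_richardsZheng (r : ℕ) (γ : K) (i : Fin n) :
    X i * pderiv i (richardsZheng n r γ) =
      ∑ ν ∈ piAntidiag (univ : Finset (Fin n)) r,
        monomial (rzExponent r ν) (rzCoeff γ ν * (r - ν i)) := by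
  rw [richardsZheng_eq_sum, map_sum, mul_sum]
  refine sum_congr rfl fun ν hν => ?_
  rw [X_mul_pderiv_monomial, rzExponent_apply, smul_monomial, nsmul_eq_mul,
    Nat.cast_sub (le_of_mem_piAntidiag hν i), mul_comm]

lemma X_sq_mul_pderiv_pderiv_richardsZheng (r : ℕ) (γ : K) (i : Fin n) :
    X i ^ 2 * pderiv i (pderiv i (richardsZheng n r γ)) =
      ∑ ν ∈ piAntidiag (univ : Finset (Fin n)) r,
        monomial (rzExponent r ν) (rzCoeff γ ν * ((r - ν i) * (r - ν i - 1))) := by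
  rw [X_sq_mul_pderiv_pderiv, X_mul_pderiv_richardsZheng, map_sum, mul_sum, ← sum_sub_distrib]
  refine sum_congr rfl fun ν hν => ?_
  rw [X_mul_pderiv_monomial, rzExponent_apply, smul_monomial, nsmul_eq_mul,
    Nat.cast_sub (le_of_mem_piAntidiag hν i), ← map_sub]
  congr 1
  ring

/-- The divided difference of `x_i² ∂_i f_r` for the variables `x_i`, `x_j`. -/
def rzDividedDifference (r : ℕ) (γ : K) (i j : Fin n) : MvPolynomial (Fin n) K :=
  ∑ ν ∈ piAntidiag (univ : Finset (Fin n)) r,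
    monomial (rzExponent r ν) (rzCoeff γ ν * (r + γ⁻¹ * (ν i * ν j)))

lemma rzDividedDifference_spec (r : ℕ) {γ : K} (hγ : γ ≠ 0) {i j : Fin n} (hij : i ≠ j) :
    (X i - X j) * rzDividedDifference r γ i j =
      X i ^ 2 * pderiv i (richardsZheng n r γ) - X j ^ 2 * pderiv j (richardsZheng n r γ) := by
  have hX : ∀ (k : Fin n) (d : Fin n →₀ ℕ) (c : K),
      X k * monomial d c = monomial (Finsupp.single k 1 + d) c := by
    intro k d c
    rw [X, monomial_mul, one_mul]
  -- Coefficientwise, `r + ν_i ν_j / γ - (r - ν_i) = ν_i (ν_j + γ) / γ`; the resulting sum is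
  -- symmetric in `i` and `j` by `sum_monomial_shift`.
  have key : ∀ i j : Fin n, X i * rzDividedDifference r γ i j -
      X i ^ 2 * pderiv i (richardsZheng n r γ) =
      C γ⁻¹ * ∑ ν ∈ piAntidiag (univ : Finset (Fin n)) r,
      monomial (Finsupp.single i 1 + rzExponent r ν) (rzCoeff γ ν * ν i * (ν j + γ)) := by
    intro i j
    rw [pow_two, mul_assoc, X_mul_pderiv_richardsZheng, rzDividedDifference, mul_sum, mul_sum,
      mul_sum, ← sum_sub_distrib]
    refine sum_congr rfl fun ν _ => ?_
    rw [hX, hX, ← map_sub, C_mul_monomial]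
    congr 1
    field_simp
    ring
  have hsymm : rzDividedDifference r γ i j = rzDividedDifference r γ j i := by
    refine sum_congr rfl fun ν _ => ?_
    rw [mul_comm (ν i : K)]
  have h1 := key i j
  have h2 := key j i
  rw [sum_monomial_shift r γ hij, ← h2, ← hsymm] at h1
  linear_combination h1

theorem laplaceBeltrami_richardsZheng [CharZero K] (r : ℕ) {γ : K} (hγ : γ ≠ 0) :
    laplaceBeltrami γ⁻¹ (richardsZheng n r γ) =
      algebraMap _ (FractionRing (MvPolynomial (Fin n) K))
        (C (γ⁻¹ / 2 * ((r - 1) * (n * r - r)) + n * (n - 1) * r / 2) * richardsZheng n r γ) := by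
  rw [laplaceBeltrami_eq _ _ (rzDividedDifference r γ)
    fun i j hij => rzDividedDifference_spec r hγ hij]
  congr 1
  simp only [X_sq_mul_pderiv_pderiv_richardsZheng]
  rw [richardsZheng_eq_sum, sum_comm]
  have h2 : ∀ i : Fin n, ∑ j ∈ univ.erase i, rzDividedDifference r γ i j =
      ∑ ν ∈ piAntidiag (univ : Finset (Fin n)) r, monomial (rzExponent r ν)
        (∑ j ∈ univ.erase i, rzCoeff γ ν * (r + γ⁻¹ * (ν i * ν j))) := by
    intro i
    simp only [rzDividedDifference, map_sum]
    exact sum_comm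
  simp only [h2]
  rw [sum_comm (s := univ) (t := piAntidiag univ r), mul_sum, mul_sum, mul_sum, ← sum_add_distrib]
  refine sum_congr rfl fun ν hν => ?_
  rw [← map_sum, ← map_sum, C_mul_monomial, C_mul_monomial, C_mul_monomial, ← map_add]
  congr 1
  have hsum : ∑ i, (ν i : K) = r := by exact_mod_cast (mem_piAntidiag.1 hν).1
  have hinner : ∀ i, ∑ j ∈ univ.erase i, rzCoeff γ ν * (r + γ⁻¹ * (ν i * ν j)) =
      rzCoeff γ ν * ((n - 1) * r + γ⁻¹ * (ν i * (r - ν i))) := by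
    intro i
    rw [← mul_sum, sum_add_distrib, ← mul_sum, ← mul_sum,
      sum_erase_eq_sub (f := fun j => (ν j : K)) (mem_univ i), hsum, sum_const, card_erase_of_mem (mem_univ i), card_univ, Fintype.card_fin, nsmul_eq_mul,
      Nat.cast_pred (Fin.pos i)]
  simp only [hinner]
  rw [← mul_sum, ← mul_sum]
  -- The quadratic terms in `ν` cancel between the second-order part and the divided differences,
  -- leaving a scalar independent of `ν`.
  have h3 : ∑ i, (((r : K) - ν i) * (r - ν i - 1)) + ∑ i, (ν i : K) * (r - ν i) =
      (r - 1) * (n * r - r) := by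
    rw [← sum_add_distrib]
    have : ∀ i, ((r : K) - ν i) * (r - ν i - 1) + ν i * (r - ν i) = (r - 1) * (r - ν i) := by
      intro i; ring
    simp only [this]
    rw [← mul_sum, sum_sub_distrib, hsum]
    simp
  rw [sum_add_distrib, ← mul_sum (a := γ⁻¹)]
  simp only [sum_const, card_univ, Fintype.card_fin, nsmul_eq_mul]
  linear_combination (γ⁻¹ / 2 * rzCoeff γ ν) * h3

lemma laplaceBeltrami_C_mul (α c : K) (P : MvPolynomial (Fin n) K) :
    laplaceBeltrami α (C c * P) =
      algebraMap (MvPolynomial (Fin n) K) (FractionRing (MvPolynomial (Fin n) K)) (C c) *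
        laplaceBeltrami α P := by
  have h1 : C (α / 2) * ∑ i, X i ^ 2 * pderiv i (pderiv i (C c * P)) =
      C c * (C (α / 2) * ∑ i, X i ^ 2 * pderiv i (pderiv i P)) := by
    simp only [pderiv_C_mul, mul_left_comm _ (C c), ← mul_sum]
  unfold laplaceBeltrami
  extract_lets ι
  have h2 : ∀ i j : Fin n, ι (X i) ^ 2 / (ι (X i) - ι (X j)) * ι (pderiv i (C c * P)) =
      ι (C c) * (ι (X i) ^ 2 / (ι (X i) - ι (X j)) * ι (pderiv i P)) := by
    intro i j
    rw [pderiv_C_mul, map_mul, mul_left_comm]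
  rw [h1, map_mul ι (C c), mul_add (ι (C c)), mul_sum _ _ (ι (C c))]
  simp only [h2, mul_sum]

lemma sum_rect (hn : 1 ≤ n) (r : ℕ) : ∑ i, rect n r i + r = n * r := by
  obtain ⟨k, rfl⟩ := Nat.exists_eq_add_of_le' hn
  rw [Fin.sum_univ_castSucc]
  simp [rect, Nat.succ_mul]

/-- All exponents are at most `r`, which settles every proper partial sum; the last one is the size.
-/
lemma dominatedBy_rect {r : ℕ} {ν : Fin n → ℕ} (hn : 1 ≤ n) (hν : ν ∈ piAntidiag univ r) :
    DominatedBy (fun i => r - ν i) (rect n r) := by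
  have hsum : ∑ i, (r - ν i) = ∑ i, rect n r i := by
    have h1 : ∑ i, (r - ν i) + ∑ i, ν i = n * r := by
      rw [← sum_add_distrib, sum_congr rfl fun i _ => Nat.sub_add_cancel (le_of_mem_piAntidiag hν i)]
      simp
    rw [(mem_piAntidiag.1 hν).1] at h1
    have := sum_rect hn r
    omega
  refine ⟨hsum, fun k => ?_⟩
  by_cases hk : (k : ℕ) + 1 < n
  · refine sum_le_sum fun i hi => ?_
    have : (i : ℕ) ≤ k := Fin.le_def.1 (mem_Iic.1 hi)
    rw [rect, if_pos (by omega)]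
    exact Nat.sub_le _ _
  · have : Iic k = univ := by
      ext i
      simp only [mem_Iic, mem_univ, iff_true, Fin.le_def]
      omega
    rw [this, hsum]

lemma rzExponent_single {k : ℕ} (r : ℕ) :
    rzExponent r (Pi.single (Fin.last k) r) = Finsupp.equivFunOnFinite.symm (rect (k + 1) r) := by
  ext i
  rw [rzExponent_apply, Finsupp.equivFunOnFinite_symm_apply_apply, rect]
  rcases eq_or_ne i (Fin.last k) with rfl | hi
  · simp
  · rw [Pi.single_eq_of_ne hi, if_pos (Nat.succ_lt_succ (Fin.val_lt_last hi)), Nat.sub_zero]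

/-- Only `ν = (0, …, 0, r)` contributes, with multinomial coefficient 1. -/
lemma coeff_rect_richardsZheng (hn : 1 ≤ n) (r : ℕ) (γ : K) :
    (richardsZheng n r γ).coeff (Finsupp.equivFunOnFinite.symm (rect n r)) = poch γ r := by
  obtain ⟨k, rfl⟩ := Nat.exists_eq_add_of_le' hn
  have hmem : (Pi.single (Fin.last k) r : Fin (k + 1) → ℕ) ∈ piAntidiag univ r := by
    rw [mem_piAntidiag]
    simp
  rw [← rzExponent_single, coeff_richardsZheng γ hmem, rzCoeff,
    Nat.multinomial_single, Fin.prod_univ_castSucc]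
  simp [poch_zero]

theorem isJack_richardsZheng [CharZero K] (hn : 1 ≤ n) (r : ℕ) {γ : K} (hγ : γ ≠ 0)
    (hr : poch γ r ≠ 0) :
    IsJack γ⁻¹ (rect n r) (C (poch γ r)⁻¹ * richardsZheng n r γ) where
  symmetric := (IsSymmetric.C _).mul (richardsZheng_isSymmetric r γ)
  coeff_self := by rw [coeff_C_mul, coeff_rect_richardsZheng hn, inv_mul_cancel₀ hr]
  triangular := by
    intro μ _ h
    rw [coeff_C_mul] at h
    obtain ⟨ν, hν, h⟩ := exists_of_coeff_richardsZheng_ne_zero (right_ne_zero_of_mul h)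
    have : (fun i => r - ν i) = μ := Finsupp.equivFunOnFinite.symm.injective h
    exact this ▸ dominatedBy_rect hn hν
  eigen := by
    refine ⟨γ⁻¹ / 2 * ((r - 1) * (n * r - r)) + n * (n - 1) * r / 2, ?_⟩
    rw [laplaceBeltrami_C_mul, laplaceBeltrami_richardsZheng r hγ, ← map_mul, mul_left_comm]

end Eigenfunction

/-! ### Poles and specialisation to complex `γ` -/

section Specialisation

variable {n : ℕ}

lemma poch_eq_prod {R : Type*} [CommRing R] (a : R) (k : ℕ) :
    poch a k = ∏ i ∈ range k, (a + i) := by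
  induction k with
  | zero => simp [poch_zero]
  | succ k ih => rw [poch_succ, ih, prod_range_succ]

lemma algebraMap_poch_X (r : ℕ) :
    algebraMap (Polynomial ℚ) (RatFunc ℚ) (poch Polynomial.X r) = poch RatFunc.X r := by
  rw [poch_map, RatFunc.algebraMap_X]

lemma poch_polynomialX_ne_zero (r : ℕ) : poch (Polynomial.X : Polynomial ℚ) r ≠ 0 := by
  rw [poch_eq_prod, prod_ne_zero_iff]
  intro i _
  exact_mod_cast Polynomial.X_add_C_ne_zero (i : ℚ)

lemma poch_ratFuncX_ne_zero (r : ℕ) : poch (RatFunc.X : RatFunc ℚ) r ≠ 0 := by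
  rw [← algebraMap_poch_X]
  exact RatFunc.algebraMap_ne_zero (poch_polynomialX_ne_zero r)

lemma isJack_rect (hn : 1 ≤ n) (r : ℕ) :
    IsJack (RatFunc.X : RatFunc ℚ)⁻¹ (rect n r)
      (C (poch RatFunc.X r)⁻¹ * richardsZheng n r RatFunc.X) :=
  isJack_richardsZheng hn r RatFunc.X_ne_zero (poch_ratFuncX_ne_zero r)

lemma jack_rect (hn : 1 ≤ n) (r : ℕ) :
    jack (rect n r) = C (poch RatFunc.X r)⁻¹ * richardsZheng n r RatFunc.X :=
  (Classical.epsilon_spec ⟨_, isJack_rect hn r⟩ :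
    IsJack (RatFunc.X : RatFunc ℚ)⁻¹ (rect n r) (jack (rect n r))).unique ratFunc_inv_X_linear
    (isJack_rect hn r)

lemma richardsZheng_eq_jack (hn : 1 ≤ n) (r : ℕ) :
    richardsZheng n r (RatFunc.X : RatFunc ℚ) = C (poch RatFunc.X r) * jack (rect n r) := by
  rw [jack_rect hn, ← mul_assoc, ← C_mul, mul_inv_cancel₀ (poch_ratFuncX_ne_zero r), C_1, one_mul]

lemma algebraMap_coeff_richardsZheng (r : ℕ) (m : Fin n →₀ ℕ) :
    algebraMap (Polynomial ℚ) (RatFunc ℚ) ((richardsZheng n r Polynomial.X).coeff m) =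
      (richardsZheng n r RatFunc.X).coeff m := by
  rw [← coeff_map, map_richardsZheng, RatFunc.algebraMap_X]

/-- Apart from the factor `X`, common to all coefficients of `f_r(x; X)`, the denominators of the
Jack polynomial divide `(X + 1) ⋯ (X + r - 1)`. -/
lemma exists_coeff_jack_eq_div (hn : 1 ≤ n) (r : ℕ) (m : Fin n →₀ ℕ) :
    ∃ q : Polynomial ℚ, (jack (rect n r)).coeff m = algebraMap _ (RatFunc ℚ) q /
      algebraMap _ (RatFunc ℚ) (∏ k ∈ range (r - 1), (Polynomial.X + (k + 1 : Polynomial ℚ))) := by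
  rw [jack_rect hn, coeff_C_mul, ← algebraMap_coeff_richardsZheng, ← algebraMap_poch_X]
  by_cases h : (richardsZheng n r (Polynomial.X : Polynomial ℚ)).coeff m = 0
  · exact ⟨0, by rw [h]; simp⟩
  obtain ⟨ν, hν, rfl⟩ := exists_of_coeff_richardsZheng_ne_zero h
  rw [coeff_richardsZheng _ hν]
  -- For `r = 0` there is no factor `X` to cancel, and the product over `range (0 - 1)` is empty.
  rcases r with _ | r
  · exact ⟨rzCoeff Polynomial.X ν, by simp [poch_zero]⟩
  have hdvd : (Polynomial.X : Polynomial ℚ) ∣ rzCoeff Polynomial.X ν := by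
    obtain ⟨i, -, hi⟩ : ∃ i ∈ univ, ν i ≠ 0 := by
      apply exists_ne_zero_of_sum_ne_zero
      rw [(mem_piAntidiag.1 hν).1]
      omega
    refine Dvd.dvd.mul_left ((?_ : Polynomial.X ∣ poch Polynomial.X (ν i)).trans
      (dvd_prod_of_mem (fun i => poch (Polynomial.X : Polynomial ℚ) (ν i)) (mem_univ i))) _
    rw [poch_eq_prod]
    refine dvd_trans (dvd_of_eq ?_) (dvd_prod_of_mem (fun k : ℕ => Polynomial.X + (k : Polynomial ℚ))
      (mem_range.2 (Nat.pos_of_ne_zero hi)))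
    rw [Nat.cast_zero, add_zero]
  obtain ⟨q, hq⟩ := hdvd
  refine ⟨q, ?_⟩
  rw [hq, poch_eq_prod, prod_range_succ']
  simp only [Nat.add_sub_cancel, Nat.cast_zero, add_zero, Nat.cast_add, Nat.cast_one, map_mul,
    RatFunc.algebraMap_X, mul_inv]
  have hX : (RatFunc.X : RatFunc ℚ) ≠ 0 := RatFunc.X_ne_zero
  rw [div_eq_mul_inv]
  field_simp

theorem jackRegularAt_rect (hn : 1 ≤ n) (r : ℕ) (γ : ℂ)
    (h : ∀ k : ℕ, 1 ≤ k → k < r → γ ≠ -(k : ℂ)) : JackRegularAt (rect n r) γ := by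
  intro m h0
  obtain ⟨q, hq⟩ := exists_coeff_jack_eq_div hn r m
  have hdvd := RatFunc.denom_div_dvd q
    (∏ k ∈ range (r - 1), (Polynomial.X + (k + 1 : Polynomial ℚ)))
  rw [← hq] at hdvd
  have := Polynomial.eval₂_eq_zero_of_dvd_of_eval₂_eq_zero (algebraMap ℚ ℂ) γ hdvd h0
  rw [Polynomial.eval₂_finsetProd, prod_eq_zero_iff] at this
  obtain ⟨k, hk, hk0⟩ := this
  rw [mem_range] at hk
  refine h (k + 1) (by omega) (by omega) ?_
  simp only [Polynomial.eval₂_add, Polynomial.eval₂_X, Polynomial.eval₂_natCast,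
    Polynomial.eval₂_one] at hk0
  push_cast
  linear_combination hk0

lemma coeff_jackAt (lam : Fin n → ℕ) (γ : ℂ) (m : Fin n →₀ ℕ) :
    (jackAt lam γ).coeff m = RatFunc.eval (algebraMap ℚ ℂ) γ ((jack lam).coeff m) := by
  rw [jackAt, coeff_sum]
  simp only [coeff_monomial]
  rw [sum_ite_eq', ite_eq_left_iff]
  intro h
  rw [notMem_support_iff.1 h, RatFunc.eval_zero]

theorem richardsZheng_eq_jackAt (hn : 1 ≤ n) (r : ℕ) (γ : ℂ)
    (h : JackRegularAt (rect n r) γ) :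
    richardsZheng n r γ = C (poch γ r) * jackAt (rect n r) γ := by
  have heval : ∀ p : Polynomial ℚ,
      RatFunc.eval (algebraMap ℚ ℂ) γ (algebraMap (Polynomial ℚ) (RatFunc ℚ) p) =
        Polynomial.eval₂RingHom (algebraMap ℚ ℂ) γ p := by
    intro p
    rw [RatFunc.eval_algebraMap]
    rfl
  have hX : Polynomial.eval₂RingHom (algebraMap ℚ ℂ) γ Polynomial.X = γ := by simp
  ext m
  have h1 := congrArg (coeff m) (richardsZheng_eq_jack hn r)
  rw [coeff_C_mul, ← algebraMap_coeff_richardsZheng, ← algebraMap_poch_X] at h1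
  have h2 := congrArg (RatFunc.eval (algebraMap ℚ ℂ) γ) h1
  -- Evaluation is multiplicative only where neither denominator vanishes; here one is 1 and the
  -- other is controlled by regularity.
  have h3 := RatFunc.eval_mul (f := algebraMap ℚ ℂ) (a := γ)
    (x := algebraMap (Polynomial ℚ) (RatFunc ℚ) (poch Polynomial.X r)) (by simp) (h m)
  rw [h3, heval, heval, poch_map, hX, ← coeff_map,
    map_richardsZheng, hX] at h2
  rw [coeff_C_mul, coeff_jackAt, h2]

end Specialisation

/-! ### Comparison of the conditions and of the Gamma products -/

section Values

lemma rzCondition_iff_kadellCondition {n : ℕ} (hn : 1 ≤ n) (r : ℕ) (α β γ : ℂ) :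
    RZCondition n r α β γ ↔ KadellCondition (rect n r) α β γ := by
  obtain ⟨k, rfl⟩ := Nat.exists_eq_add_of_le' hn
  unfold RZCondition KadellCondition
  have hr : (0 : ℝ) ≤ r := Nat.cast_nonneg r
  constructor
  · rintro ⟨hα, hβ, hγ, hαγ, hβγ⟩
    refine ⟨fun i => ?_, hβ, hγ, hβγ⟩
    have hik : ((i : ℕ) : ℝ) ≤ k := by exact_mod_cast Nat.lt_succ_iff.1 i.2
    push_cast at hαγ ⊢
    rcases eq_or_ne (i : ℕ) k with hi | hi
    · simp [rect, hi, hα]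
    · have : (i : ℕ) + 1 < k + 1 := by have := i.2; omega
      rw [rect, if_pos this]
      -- The bound is affine in `i`: for `Re γ ≥ 0` it follows from `Re α > 0`, otherwise from the
      -- bound at `i = 0`.
      rcases le_or_gt 0 γ.re with h | h
      · nlinarith
      · nlinarith [(Nat.cast_nonneg (i : ℕ) : (0 : ℝ) ≤ _)]
  · rintro ⟨hα, hβ, hγ, hβγ⟩
    have hlast := hα (Fin.last k)
    have h0 := hα 0
    simp [rect] at hlast
    refine ⟨hlast, hβ, hγ, ?_, hβγ⟩
    push_cast at h0 ⊢
    rcases Nat.eq_zero_or_pos k with rfl | hk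
    · simp; linarith
    · simpa [rect, hk] using h0

lemma neg_one_lt_re {n : ℕ} (hn : 1 ≤ n) {γ : ℂ} (h : -(1 / (n : ℝ)) < γ.re) : -1 < γ.re := by
  have : 1 / (n : ℝ) ≤ 1 := by
    rw [div_le_one (by exact_mod_cast hn)]
    exact_mod_cast hn
  linarith

lemma ne_neg_natCast {n : ℕ} (hn : 1 ≤ n) {γ : ℂ} (h : -(1 / (n : ℝ)) < γ.re) {k : ℕ}
    (hk : 1 ≤ k) : γ ≠ -(k : ℂ) := by
  intro h'
  have := neg_one_lt_re hn h
  rw [h'] at this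
  have hk' : (1 : ℝ) ≤ k := by exact_mod_cast hk
  simp at this
  omega

lemma poch_ne_zero {s : ℂ} (r : ℕ) (h : ∀ m : ℕ, s ≠ -m) : poch s r ≠ 0 := by
  rw [poch_eq_prod, prod_ne_zero_iff]
  intro i _ h0
  exact h i (eq_neg_of_add_eq_zero_left h0)

lemma Gamma_add_natCast {s : ℂ} (r : ℕ) (h : ∀ m : ℕ, s ≠ -m) :
    Complex.Gamma (s + r) = poch s r * Complex.Gamma s := by
  induction r with
  | zero => simp [poch_zero]
  | succ r ih =>
    have h0 : s + r ≠ 0 := fun h0 => h r (eq_neg_of_add_eq_zero_left h0)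
    rw [poch_succ, Nat.cast_succ, ← add_assoc, Complex.Gamma_add_one _ h0, ih]
    ring

/-- Since `Re (p γ) > -1`, equality would force `s = m = 0` and then `p γ = 0`. This keeps the Gamma
functions cancelled in the telescoping away from their poles. -/
lemma mul_add_ne_neg_natCast {k : ℕ} {γ : ℂ} (hγ0 : γ ≠ 0)
    (hγ : -(1 / ((k + 1 : ℕ) : ℝ)) < γ.re) {p : ℕ} (hp : 1 ≤ p) (hpk : p ≤ k + 1) (s m : ℕ) :
    (p : ℂ) * γ + s ≠ -m := by
  intro h
  have hre := congrArg Complex.re h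
  simp only [Complex.add_re, Complex.mul_re, Complex.natCast_re, Complex.natCast_im, zero_mul,
    sub_zero, Complex.neg_re] at hre
  have hp' : (0 : ℝ) < p := by exact_mod_cast hp
  have hk' : (0 : ℝ) < ((k + 1 : ℕ) : ℝ) := by positivity
  have hpk' : (p : ℝ) ≤ ((k + 1 : ℕ) : ℝ) := by exact_mod_cast hpk
  have h1 : -1 < (p : ℝ) * γ.re := by
    have h2 : (p : ℝ) * (1 / ((k + 1 : ℕ) : ℝ)) ≤ 1 := by
      rw [mul_one_div, div_le_one hk']; exact hpk'
    nlinarith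
  have h3 : ((s + m : ℕ) : ℝ) < 1 := by push_cast; linarith
  have h4 : s + m < 1 := by exact_mod_cast h3
  have hs : s = 0 := by omega
  have hm : m = 0 := by omega
  subst hs hm
  simp only [Nat.cast_zero, add_zero, neg_zero, mul_eq_zero, Nat.cast_eq_zero] at h
  rcases h with h | h
  · omega
  · exact hγ0 h

lemma prod_range_div_telescope (f : ℕ → ℂ) (p : ℕ) (hf : ∀ m ≤ p, f m ≠ 0) :
    ∏ m ∈ range p, f (m + 1) / f m = f p / f 0 := by
  induction p with
  | zero => simp [hf 0 le_rfl]
  | succ p ih =>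
    rw [prod_range_succ, ih fun m hm => hf m (by omega)]
    have := hf p (by omega)
    have := hf 0 (by omega)
    field_simp

lemma prod_Ioi_eq_prod_range {k : ℕ} (i : Fin (k + 1)) (F : ℕ → ℂ) :
    ∏ j ∈ Ioi i, F j = ∏ m ∈ range (k - i), F (i + 1 + m) := by
  have h1 : ∏ j ∈ Ioi i, F j = ∏ j ∈ (Ioi i).map Fin.valEmbedding, F j := by
    rw [prod_map]; rfl
  have h2 : (Ioi i).map Fin.valEmbedding = Ico ((i : ℕ) + 1) (k + 1) := by
    ext j
    simp only [mem_map, mem_Ioi, Fin.valEmbedding_apply, mem_Ico]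
    constructor
    · rintro ⟨a, ha, rfl⟩
      exact ⟨ha, a.2⟩
    · rintro ⟨ha, hb⟩
      exact ⟨⟨j, hb⟩, ha, rfl⟩
  rw [h1, h2, prod_Ico_eq_prod_range, Nat.add_sub_add_right]

variable {k : ℕ} {γ : ℂ}

/-- For `j` before the last index the parts are equal and the quotients telescope; the last index
has part 0 and gives the factor containing `r`. -/
lemma prod_Ioi_Gamma (hγ0 : γ ≠ 0) (hγ : -(1 / ((k + 1 : ℕ) : ℝ)) < γ.re) (r p : ℕ)
    (i : Fin (k + 1)) (hi : (i : ℕ) + p + 1 = k) :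
    ∏ j ∈ Ioi i,
      Complex.Gamma ((((j : ℕ) : ℂ) - (i : ℕ) + 1) * γ + rect (k + 1) r i - rect (k + 1) r j) /
        Complex.Gamma ((((j : ℕ) : ℂ) - (i : ℕ)) * γ + rect (k + 1) r i - rect (k + 1) r j) =
    Complex.Gamma (((p + 1 : ℕ) : ℂ) * γ) / Complex.Gamma γ *
      (Complex.Gamma (((p + 2 : ℕ) : ℂ) * γ + r) / Complex.Gamma (((p + 1 : ℕ) : ℂ) * γ + r)) := by
  have hrect : rect (k + 1) r i = r := by rw [rect, if_pos (by omega)]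
  rw [hrect]
  refine (prod_Ioi_eq_prod_range i fun j =>
    Complex.Gamma (((j : ℂ) - (i : ℕ) + 1) * γ + r - (if j + 1 < k + 1 then r else 0 : ℕ)) /
      Complex.Gamma (((j : ℂ) - (i : ℕ)) * γ + r - (if j + 1 < k + 1 then r else 0 : ℕ))).trans ?_
  rw [show k - (i : ℕ) = p + 1 by omega, prod_range_succ, if_neg (by omega)]
  congr 1
  · have h := prod_range_div_telescope (fun m => Complex.Gamma (((m + 1 : ℕ) : ℂ) * γ)) p
      fun m hm => Complex.Gamma_ne_zero fun q => by
        simpa using mul_add_ne_neg_natCast hγ0 hγ (p := m + 1) (by omega) (by omega) 0 q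
    simp only [zero_add, Nat.cast_one, one_mul] at h
    rw [← h]
    refine prod_congr rfl fun m hm => ?_
    rw [mem_range] at hm
    rw [if_pos (by omega)]
    push_cast
    congr 2 <;> ring
  · push_cast
    congr 2 <;> ring

lemma prod_prod_Gamma (hγ0 : γ ≠ 0) (hγ : -(1 / ((k + 1 : ℕ) : ℝ)) < γ.re) (r : ℕ) :
    ∏ i : Fin (k + 1), ∏ j ∈ Ioi i,
      Complex.Gamma ((((j : ℕ) : ℂ) - (i : ℕ) + 1) * γ + rect (k + 1) r i - rect (k + 1) r j) /
        Complex.Gamma ((((j : ℕ) : ℂ) - (i : ℕ)) * γ + rect (k + 1) r i - rect (k + 1) r j) =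
    (∏ p ∈ range k, Complex.Gamma (((p + 1 : ℕ) : ℂ) * γ)) / Complex.Gamma γ ^ k *
      (Complex.Gamma (((k + 1 : ℕ) : ℂ) * γ + r) / Complex.Gamma (γ + r)) := by
  rw [Fin.prod_univ_castSucc]
  have hlast : (Ioi (Fin.last k)) = ∅ := by
    ext j; simpa using Fin.le_last j
  rw [hlast, prod_empty, mul_one]
  have h1 : ∀ i : Fin k, _ := fun i =>
    prod_Ioi_Gamma hγ0 hγ r (k - 1 - i) i.castSucc (by have := i.2; simp; omega)
  rw [prod_congr rfl fun i _ => h1 i, Fin.prod_univ_eq_prod_range (fun i =>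
    Complex.Gamma (((k - 1 - i + 1 : ℕ) : ℂ) * γ) / Complex.Gamma γ *
      (Complex.Gamma (((k - 1 - i + 2 : ℕ) : ℂ) * γ + r) /
        Complex.Gamma (((k - 1 - i + 1 : ℕ) : ℂ) * γ + r))) k,
    prod_range_reflect (fun p => Complex.Gamma (((p + 1 : ℕ) : ℂ) * γ) / Complex.Gamma γ *
      (Complex.Gamma (((p + 2 : ℕ) : ℂ) * γ + r) / Complex.Gamma (((p + 1 : ℕ) : ℂ) * γ + r))) k,
    prod_mul_distrib, prod_div_distrib, prod_const, card_range]
  congr 1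
  have h := prod_range_div_telescope (fun m => Complex.Gamma (((m + 1 : ℕ) : ℂ) * γ + r)) k
    fun m hm => Complex.Gamma_ne_zero fun q =>
      mul_add_ne_neg_natCast hγ0 hγ (p := m + 1) (by omega) (by omega) r q
  simp only [zero_add, Nat.cast_one, one_mul] at h
  exact h

lemma prod_Gamma_add_one (hγ0 : γ ≠ 0) :
    ∏ i ∈ range (k + 1), Complex.Gamma (((i + 1 : ℕ) : ℂ) * γ + 1) =
      (k + 1).factorial * γ ^ (k + 1) *
        ∏ i ∈ range (k + 1), Complex.Gamma (((i + 1 : ℕ) : ℂ) * γ) := by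
  have h : ∀ i : ℕ, Complex.Gamma (((i + 1 : ℕ) : ℂ) * γ + 1) =
      ((i + 1 : ℕ) : ℂ) * γ * Complex.Gamma (((i + 1 : ℕ) : ℂ) * γ) := fun i =>
    Complex.Gamma_add_one _ (mul_ne_zero (Nat.cast_ne_zero.2 (Nat.succ_ne_zero i)) hγ0)
  simp only [h, prod_mul_distrib, prod_const, card_range]
  rw [← prod_range_add_one_eq_factorial, Nat.cast_prod]

/-- The part of the comparison free of `α` and `β`; the factorial comes from `Γ(iγ + 1) = iγ Γ(iγ)`.
-/
lemma poch_mul_prod_Gamma (hγ0 : γ ≠ 0) (hγ : -(1 / ((k + 1 : ℕ) : ℝ)) < γ.re) (r : ℕ) :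
    poch (((k + 1 : ℕ) : ℂ) * γ) r *
        (∏ i ∈ range (k + 1), Complex.Gamma (((i + 1 : ℕ) : ℂ) * γ + 1)) /
        Complex.Gamma (γ + 1) ^ (k + 1) =
      (k + 1).factorial * poch γ r *
        ((∏ p ∈ range k, Complex.Gamma (((p + 1 : ℕ) : ℂ) * γ)) / Complex.Gamma γ ^ k *
          (Complex.Gamma (((k + 1 : ℕ) : ℂ) * γ + r) / Complex.Gamma (γ + r))) := by
  have hpole : ∀ m : ℕ, γ ≠ -m := fun m => by
    simpa using mul_add_ne_neg_natCast hγ0 hγ (p := 1) le_rfl (by omega) 0 m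
  have hpole' : ∀ m : ℕ, ((k + 1 : ℕ) : ℂ) * γ ≠ -m := fun m => by
    simpa using mul_add_ne_neg_natCast hγ0 hγ (p := k + 1) (by omega) le_rfl 0 m
  have hG := Complex.Gamma_ne_zero hpole
  have hp := poch_ne_zero r hpole
  rw [prod_Gamma_add_one hγ0, Complex.Gamma_add_one _ hγ0, Gamma_add_natCast r hpole,
    Gamma_add_natCast r hpole', prod_range_succ, mul_pow, pow_succ (Complex.Gamma γ) k]
  field_simp

end Values

theorem rzValue_eq {n : ℕ} (hn : 1 ≤ n) (r : ℕ) {α β γ : ℂ} (h : RZCondition n r α β γ)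
    (hγ0 : γ ≠ 0) :
    rzValue n r α β γ = (n.factorial : ℂ) * poch γ r * kadellValue (rect n r) α β γ := by
  obtain ⟨k, rfl⟩ := Nat.exists_eq_add_of_le' hn
  obtain ⟨hα, hβ, hγ, hαγ, hβγ⟩ := h
  have hr : (0 : ℝ) ≤ r := Nat.cast_nonneg r
  set A : ℕ → ℂ := fun i => Complex.Gamma (α + i * γ + r) with hA
  set B : ℕ → ℂ := fun i => Complex.Gamma (β + i * γ) with hB
  set E : ℕ → ℂ := fun i => Complex.Gamma (α + β + (k + i) * γ + r) with hE
  have hA0 : A 0 ≠ 0 := by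
    refine Complex.Gamma_ne_zero_of_re_pos ?_
    simp
    linarith
  have hE0 : E 0 ≠ 0 := by
    refine Complex.Gamma_ne_zero_of_re_pos ?_
    simp at hβγ ⊢
    linarith
  have hR : rzValue (k + 1) r α β γ = poch (((k + 1 : ℕ) : ℂ) * γ) r *
        (∏ i ∈ range (k + 1), Complex.Gamma (((i + 1 : ℕ) : ℂ) * γ + 1)) /
        Complex.Gamma (γ + 1) ^ (k + 1) *
      (Complex.Gamma α * E 0 / (A 0 * Complex.Gamma (α + β + k * γ)) *
        ((∏ i ∈ range (k + 1), A i) * (∏ i ∈ range (k + 1), B i) / ∏ i ∈ range (k + 1), E i)) := by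
    have h1 : ∏ i : Fin (k + 1),
      Complex.Gamma (α + (i : ℕ) * γ + r) * Complex.Gamma (β + (i : ℕ) * γ) *
          Complex.Gamma (((i : ℕ) + 1) * γ + 1) /
        (Complex.Gamma (α + β + ((i : ℕ) + ((k + 1 : ℕ) : ℂ) - 1) * γ + r) *
          Complex.Gamma (γ + 1)) =
        (∏ i ∈ range (k + 1), A i) * (∏ i ∈ range (k + 1), B i) *
        (∏ i ∈ range (k + 1), Complex.Gamma (((i + 1 : ℕ) : ℂ) * γ + 1)) /
        ((∏ i ∈ range (k + 1), E i) * Complex.Gamma (γ + 1) ^ (k + 1)) := by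
      rw [Fin.prod_univ_eq_prod_range (fun i : ℕ =>
        Complex.Gamma (α + i * γ + r) * Complex.Gamma (β + i * γ) *
          Complex.Gamma ((i + 1) * γ + 1) /
        (Complex.Gamma (α + β + (i + ((k + 1 : ℕ) : ℂ) - 1) * γ + r) *
          Complex.Gamma (γ + 1))) (k + 1), prod_div_distrib, prod_mul_distrib, prod_mul_distrib,
        prod_mul_distrib, prod_const, card_range]
      have hE' : ∀ i : ℕ, Complex.Gamma (α + β + (i + ((k + 1 : ℕ) : ℂ) - 1) * γ + r) = E i := by
        intro i
        simp only [hE]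
        congr 1
        push_cast
        ring
      simp only [hE']
      simp only [hA, hB, Nat.cast_add, Nat.cast_one]
    rw [rzValue, h1]
    simp only [hE, hA, Nat.cast_zero, add_zero, zero_mul]
    have h2 : (((k + 1 : ℕ) : ℂ) - 1) = k := by push_cast; ring
    rw [h2]
    ring
  have hK : kadellValue (rect (k + 1) r) α β γ =
      ((∏ p ∈ range k, Complex.Gamma (((p + 1 : ℕ) : ℂ) * γ)) / Complex.Gamma γ ^ k *
          (Complex.Gamma (((k + 1 : ℕ) : ℂ) * γ + r) / Complex.Gamma (γ + r))) *
      ((∏ p ∈ range k, A (p + 1)) * Complex.Gamma α * (∏ i ∈ range (k + 1), B i) /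
        ((∏ p ∈ range k, E (p + 1)) * Complex.Gamma (α + β + k * γ))) := by
    rw [kadellValue, prod_prod_Gamma hγ0 hγ]
    congr 1
    rw [prod_div_distrib, prod_mul_distrib]
    have hcast : ∀ i : Fin k, rect (k + 1) r i.castSucc = r := fun i => by
      have := i.2
      rw [rect, if_pos (by simp)]
    have hlast : rect (k + 1) r (Fin.last k) = 0 := by simp [rect]
    have hsub : ∀ i : Fin k, ((k - 1 - (i : ℕ) : ℕ) : ℂ) = k - 1 - (i : ℕ) := fun i => by
      have := i.2
      rw [Nat.cast_sub (by omega), Nat.cast_sub (by omega), Nat.cast_one]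
    congr 1
    · congr 1
      · rw [Fin.prod_univ_castSucc, ← prod_range_reflect (fun p => A (p + 1)),
          ← Fin.prod_univ_eq_prod_range (fun p => A (k - 1 - p + 1))]
        congr 1
        · refine prod_congr rfl fun i _ => ?_
          simp only [hA, hcast, Nat.cast_add, hsub, Fin.val_castSucc]
          congr 1
          push_cast
          ring
        · simp [hlast]
      · exact Fin.prod_univ_eq_prod_range B (k + 1)
    · rw [Fin.prod_univ_castSucc, ← prod_range_reflect (fun p => E (p + 1)),
          ← Fin.prod_univ_eq_prod_range (fun p => E (k - 1 - p + 1))]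
      congr 1
      · refine prod_congr rfl fun i _ => ?_
        simp only [hE, hcast, Nat.cast_add, hsub, Fin.val_castSucc]
        congr 1
        push_cast
        ring
      · simp only [hlast, Fin.val_last]
        congr 1
        push_cast
        ring
  -- The extra quotient in the Richards–Zheng value replaces `A 0` by `Γ(α)` and `E 0` by `Γ(α + β +
  -- kγ)`, the factors belonging to the last part, which is 0.
  rw [hR, hK, poch_mul_prod_Gamma hγ0 hγ, prod_range_succ' A, prod_range_succ' E]
  conv_rhs => rw [← mul_assoc]
  congr 1
  field_simp

/-! ### The case `γ = 0` and the equivalence of the two formulas -/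

lemma richardsZheng_zero {n r : ℕ} (hr : r ≠ 0) : richardsZheng n r (0 : ℂ) = 0 := by
  rw [richardsZheng_eq_sum]
  refine sum_eq_zero fun ν hν => ?_
  obtain ⟨i, -, hi⟩ : ∃ i ∈ univ, ν i ≠ 0 := by
    apply exists_ne_zero_of_sum_ne_zero
    rw [(mem_piAntidiag.1 hν).1]
    exact hr
  rw [rzCoeff, prod_eq_zero (mem_univ i), mul_zero, map_zero]
  rw [poch_eq_prod, prod_eq_zero (mem_range.2 (Nat.pos_of_ne_zero hi))]
  simp

open MeasureTheory in
theorem rzFormula_zero {n : ℕ} (r : ℕ) {α β : ℂ} (hα : 0 < α.re) (hβ : 0 < β.re) :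
    RZFormula n r α β 0 := by
  rcases eq_or_ne r 0 with rfl | hr
  -- With `r = 0` the integrand is a product of one-variable functions, so Fubini gives the `n`-th
  -- power of the beta integral.
  · set g : ℝ → ℂ := fun t => (t : ℂ) ^ (α - 1) * (1 - (t : ℂ)) ^ (β - 1) with hg
    have hint : rzIntegrand n 0 α β 0 = fun x => ∏ i, g (x i) := by
      funext x
      have : richardsZheng n 0 (0 : ℂ) = 1 := by
        simp [richardsZheng, poch_zero, Nat.multinomial]
      simp [rzIntegrand, this, evalReal, selbergWeight, hg]
    have hIcc : (Set.Icc 0 1 : Set (Fin n → ℝ)) = Set.univ.pi fun _ => Set.Icc 0 1 :=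
      (Set.pi_univ_Icc _ _).symm
    have hres : (volume : Measure (Fin n → ℝ)).restrict (Set.Icc 0 1) =
        Measure.pi fun _ => volume.restrict (Set.Icc 0 1) := by
      rw [hIcc, volume_pi, Measure.restrict_pi_pi]
    have hconv : Integrable g (volume.restrict (Set.Icc 0 1)) := by
      have := Complex.betaIntegral_convergent hα hβ
      rw [intervalIntegrable_iff_integrableOn_Icc_of_le zero_le_one] at this
      exact this
    have hbeta : ∫ t in Set.Icc (0 : ℝ) 1, g t = Complex.betaIntegral α β := by
      rw [Complex.betaIntegral, intervalIntegral.integral_of_le zero_le_one,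
        integral_Icc_eq_integral_Ioc]
    have hG1 : Complex.Gamma α ≠ 0 := Complex.Gamma_ne_zero_of_re_pos hα
    have hG2 : Complex.Gamma (α + β) ≠ 0 :=
      Complex.Gamma_ne_zero_of_re_pos (by rw [Complex.add_re]; linarith)
    refine ⟨?_, ?_⟩
    · rw [hint, IntegrableOn, hres]
      exact Integrable.fintype_prod fun _ => hconv
    · rw [hint, hres, integral_fintype_prod_eq_prod, prod_congr rfl fun _ _ => hbeta]
      have := Complex.Gamma_mul_Gamma_eq_betaIntegral hα hβ
      simp [rzValue, poch_zero, this, hG1, hG2]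
  · have hint : rzIntegrand n r α β 0 = 0 := by
      funext x
      simp [rzIntegrand, richardsZheng_zero hr, evalReal]
    refine ⟨by rw [hint]; exact integrableOn_zero, ?_⟩
    have : poch ((n : ℂ) * 0) r = 0 := by
      rw [poch_eq_prod, prod_eq_zero (mem_range.2 (Nat.pos_of_ne_zero hr))]
      simp
    rw [hint, rzValue, this]
    simp

lemma rzIntegrand_eq {n : ℕ} (hn : 1 ≤ n) (r : ℕ) (α β γ : ℂ)
    (h : JackRegularAt (rect n r) γ) (x : Fin n → ℝ) :
    rzIntegrand n r α β γ x = poch γ r * kadellIntegrand (rect n r) α β γ x := by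
  rw [rzIntegrand, kadellIntegrand, richardsZheng_eq_jackAt hn r γ h, evalReal, evalReal, map_mul,
    MvPolynomial.eval_C, mul_assoc]

theorem rzFormula_iff_kadellFormula {n : ℕ} (hn : 1 ≤ n) (r : ℕ) {α β γ : ℂ}
    (h : RZCondition n r α β γ) (hγ0 : γ ≠ 0) (hreg : JackRegularAt (rect n r) γ)
    (hp : poch γ r ≠ 0) : RZFormula n r α β γ ↔ KadellFormula (rect n r) α β γ := by
  have hint : rzIntegrand n r α β γ =
      fun x => poch γ r * kadellIntegrand (rect n r) α β γ x :=
    funext (rzIntegrand_eq hn r α β γ hreg)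
  have hfac : (n.factorial : ℂ) ≠ 0 := Nat.cast_ne_zero.2 n.factorial_ne_zero
  unfold RZFormula KadellFormula
  refine and_congr ?_ ?_
  · rw [hint]
    exact MeasureTheory.integrable_const_mul_iff (isUnit_iff_ne_zero.2 hp) _
  · rw [hint, MeasureTheory.integral_const_mul, rzValue_eq hn r h hγ0, mul_comm (n.factorial : ℂ),
      mul_assoc, mul_right_inj' hp, one_div_mul_eq_div, div_eq_iff hfac, mul_comm (kadellValue _ _ _ _)]

end JackSelberg

end

theorem mainTheorem2 (n r : ℕ) (hn : 1 ≤ n) :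
    -- for an indeterminate `γ`, the Jack polynomial labelled by `(r^{n-1})` is well defined
    (∃! P : MvPolynomial (Fin n) (RatFunc ℚ),
      JackSelberg.IsJack (RatFunc.X : RatFunc ℚ)⁻¹ (JackSelberg.rect n r) P) ∧
    -- the identity for an indeterminate `γ`
    JackSelberg.richardsZheng n r (RatFunc.X : RatFunc ℚ) =
      MvPolynomial.C (JackSelberg.poch (RatFunc.X : RatFunc ℚ) r) *
        JackSelberg.jack (JackSelberg.rect n r) ∧
    -- the identity for complex `γ`
    (∀ γ : ℂ, (∀ k : ℕ, 1 ≤ k → k < r → γ ≠ -(k : ℂ)) →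
      JackSelberg.JackRegularAt (JackSelberg.rect n r) γ) ∧
    (∀ γ : ℂ, JackSelberg.JackRegularAt (JackSelberg.rect n r) γ →
      JackSelberg.richardsZheng n r γ =
        MvPolynomial.C (JackSelberg.poch γ r) *
          JackSelberg.jackAt (JackSelberg.rect n r) γ) ∧
    -- the Richards–Zheng integral is the case `(r^{n-1})` of Kadell's integral
    (∀ α β γ : ℂ, JackSelberg.RZCondition n r α β γ ↔
      JackSelberg.KadellCondition (JackSelberg.rect n r) α β γ) ∧
    (∀ α β γ : ℂ, JackSelberg.RZCondition n r α β γ →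
      JackSelberg.JackRegularAt (JackSelberg.rect n r) γ ∧
      (∀ x : Fin n → ℝ, JackSelberg.rzIntegrand n r α β γ x =
        JackSelberg.poch γ r *
          JackSelberg.kadellIntegrand (JackSelberg.rect n r) α β γ x) ∧
      (γ ≠ 0 →
        JackSelberg.poch γ r ≠ 0 ∧
        JackSelberg.rzValue n r α β γ =
          (n.factorial : ℂ) * JackSelberg.poch γ r *
            JackSelberg.kadellValue (JackSelberg.rect n r) α β γ ∧
        (JackSelberg.RZFormula n r α β γ ↔
          JackSelberg.KadellFormula (JackSelberg.rect n r) α β γ)) ∧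
      (γ = 0 → JackSelberg.RZFormula n r α β γ)) := by
  refine ⟨⟨_, JackSelberg.isJack_rect hn r, fun P hP =>
      hP.unique JackSelberg.ratFunc_inv_X_linear (JackSelberg.isJack_rect hn r)⟩,
    JackSelberg.richardsZheng_eq_jack hn r, JackSelberg.jackRegularAt_rect hn r,
    JackSelberg.richardsZheng_eq_jackAt hn r, JackSelberg.rzCondition_iff_kadellCondition hn r,
    fun α β γ h => ?_⟩
  have hreg : JackSelberg.JackRegularAt (JackSelberg.rect n r) γ :=
    JackSelberg.jackRegularAt_rect hn r γ fun k hk _ => JackSelberg.ne_neg_natCast hn h.2.2.1 hk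
  refine ⟨hreg, JackSelberg.rzIntegrand_eq hn r α β γ hreg, fun hγ0 => ?_, ?_⟩
  · have hp : JackSelberg.poch γ r ≠ 0 := JackSelberg.poch_ne_zero r fun m => by
      rcases Nat.eq_zero_or_pos m with rfl | hm
      · simpa using hγ0
      · exact JackSelberg.ne_neg_natCast hn h.2.2.1 hm
    exact ⟨hp, JackSelberg.rzValue_eq hn r h hγ0,
      JackSelberg.rzFormula_iff_kadellFormula hn r h hγ0 hreg hp⟩
  · rintro rfl
    exact JackSelberg.rzFormula_zero r h.1 h.2.1
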